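/- A space of quasi-polynomials is a complex vector space $V$ spanned by functions $p_{ij}(x)e^{\lambda_i x}$, $i=1,\dots,n$, $j=1,\dots,N_i$ ($n,N_i\ge 1$), with distinct $\lambda_i\in\mathbb C$ and polynomials satisfying $0<\deg p_{i1}<\dots<\deg p_{iN_i}$; put $N=\sum_i N_i=\dim V$. Let $\bar D_V$ be its monic fundamental operator, i.e. the unique monic linear differential operator of order $N$ annihilating $V$ (its coefficients are quotients of Wronskian determinants). Let $z_1,\dots,z_m$ be the singular points of $V$, i.e. the points where the set of orders of vanishing of the nonzero elements of $V$ is not $\{0,\dots,N-1\}$, and let $M_a$ be the smallest natural number such that $(x-z_a)^{M_a}\bar D_V$ has no poles at $z_a$. Let $V^\dagger$ be the span of the functions $\prod_a (x-z_a)^{-M_a}\,\mathrm{Wr}(f_1,\dots,f_{N-1})/\mathrm{Wr}_V$, $f_i\in V$, where $\mathrm{Wr}$ denotes the Wronskian and $\mathrm{Wr}_V$ the Wronskian of a basis of $V$. The space $U$ spanned by the functions $u\mapsto\int_{\gamma_a}e^{ux}f(x)\,dx$, with $f\in V^\dagger$, $a=1,\dots,m$, and $\gamma_a$ a small counterclockwise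 circle around $z_a$, is called bispectral dual to $V$. A subspace $W\subset\mathbb C[t]$ is called admissible, $W\in\mathrm{Gr}$, if $W=\bigcap_i W_{\lambda_i}$ for finitely many distinct points $\lambda_i\in\mathbb C$ and subspaces $W_{\lambda_i}\subset\mathbb C[t]$ such that $(t-\lambda_i)^k\,\mathbb C[t]\subset W_{\lambda_i}$ for some $k\ge0$ and some $f\in W_{\lambda_i}$ has $f(\lambda_i)\ne0$. To a space of quasi-polynomials $V$ as above, with $p_{ij}=\sum_{b\ge 0}c_{ijb}x^b$, there corresponds the subspace $$W=\Big\{r\in\mathbb C[t]\ :\ \sum_{b\ge0}c_{ijb}\,r^{(b)}(\lambda_i)=0\ \text{ for all } i,j\Big\},$$ which in turn determines $V$ as the span of all the functions $p(x)e^{\lambda x}$, $p=\sum_b c_bx^b$, $\lambda\in\mathbb C$, such that $\sum_b c_b r^{(b)}(\lambda)=0$ for all $r\in W$. The stationary Baker–Akhiezer function of $W$ is $$\Psi_W(x,\xi)=\prod_{i=1}^n(\xi-\lambda_i)^{-N_i}\ \bar D_V\,e^{x\xi}.$$ **Theorem.** Let $V$ and $U$ be spaces of quasi-polynomials such that $U$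 is bispectral dual to $V$, and let $W$ and $Y$ be the subspaces of $\mathbb C[t]$ corresponding to $V$ and $U$. Then $W$ and $Y$ are admissible, and they are bispectral dual with respect to their Baker–Akhiezer functions: $$\Psi_Y(x,\xi)=\Psi_W(\xi,x)$$ as meromorphic functions of $(x,\xi)$ (that is, at all points where both sides are defined). -/

import Mathlib

namespace Bispectral

open Polynomial

noncomputable section

/-! ### Spaces of functions and their fundamental operators -/

/-- The determinant of the matrix whose `a`-th row consists of the derivatives of `f a` of
orders `d 0, d 1, …`, evaluated at `x`. -/
def genWronskian {k : ℕ} (f : Fin k → ℂ → ℂ) (d : Fin k → ℕ) (x : ℂ) : ℂ :=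
  (Matrix.of fun a b : Fin k => iteratedDeriv (d b) (f a) x).det

/-- The Wronskian `Wr(f₁, …, f_k)`. -/
def wronskian {k : ℕ} (f : Fin k → ℂ → ℂ) (x : ℂ) : ℂ :=
  genWronskian f (fun b => (b : ℕ)) x

open Classical in
/-- A basis of a finite-dimensional space `V` of functions (zero if `V` is
infinite-dimensional). -/
def basisOf (V : Submodule ℂ (ℂ → ℂ)) : Fin (Module.finrank ℂ V) → ℂ → ℂ :=
  if _h : Module.Finite ℂ V then fun i => ((Module.finBasis ℂ V i : V) : ℂ → ℂ) else fun _ => 0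

/-- The Wronskian of `V` (well defined up to a nonzero constant). -/
def wronskianOf (V : Submodule ℂ (ℂ → ℂ)) (x : ℂ) : ℂ := wronskian (basisOf V) x

/-- The coefficient of `∂ᵏ` in the monic fundamental operator of `V`, where `N = dim V`:
`(-1)^(N-k)` times the determinant with the derivatives of orders `0, …, N` except `k`,
divided by the Wronskian of `V`. -/
def monicCoeff (V : Submodule ℂ (ℂ → ℂ)) (k : Fin (Module.finrank ℂ V + 1)) (x : ℂ) : ℂ :=
  (-1) ^ (Module.finrank ℂ V - (k : ℕ)) *
    genWronskian (basisOf V) (fun b => ((k.succAbove b : Fin (Module.finrank ℂ V + 1)) : ℕ)) x /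
      wronskianOf V x

/-- The monic fundamental operator of `V`, applied to the function `g`, at the point `x`. -/
def monicOperator (V : Submodule ℂ (ℂ → ℂ)) (g : ℂ → ℂ) (x : ℂ) : ℂ :=
  ∑ k : Fin (Module.finrank ℂ V + 1), monicCoeff V k x * iteratedDeriv (k : ℕ) g x

/-- The set of exponents of `V` at `z`: the orders at `z` of the nonzero elements of `V`. -/
def exponents (V : Submodule ℂ (ℂ → ℂ)) (z : ℂ) : Set ℤ :=
  {e | ∃ f ∈ V, meromorphicOrderAt f z = (e : WithTop ℤ)}

/-- The singular points of `V`: the points where the exponents are not `0, 1, …, dim V - 1`. -/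
def singularPoints (V : Submodule ℂ (ℂ → ℂ)) : Set ℂ :=
  {z | exponents V z ≠ Set.Ico (0 : ℤ) (Module.finrank ℂ V : ℤ)}

/-- The smallest natural number `m` such that the coefficients of `(x - z)ᵐ` times the monic
fundamental operator of `V` have no pole at `z`. -/
def poleOrder (V : Submodule ℂ (ℂ → ℂ)) (z : ℂ) : ℕ :=
  sInf {m : ℕ | ∀ k : Fin (Module.finrank ℂ V + 1),
    0 ≤ meromorphicOrderAt (fun x => (x - z) ^ m * monicCoeff V k x) z}

/-! ### The conjugate spaces and the integral transform -/

/-- The conjugate space of `V`, spanned by the functions `Wr(f₁, …, f_{N-1}) / Wr_V`. -/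
def conjugateSpace (V : Submodule ℂ (ℂ → ℂ)) : Submodule ℂ (ℂ → ℂ) :=
  Submodule.span ℂ {g | ∃ f : Fin (Module.finrank ℂ V - 1) → ℂ → ℂ, (∀ i, f i ∈ V) ∧
    g = fun x => wronskian f x / wronskianOf V x}

/-- The regularized conjugate space of `V`, spanned by the functions
`f · ∏ (x - z)^(-M_z)`, where `f` is in the conjugate space and the product is over the singular
points `z` of `V`. -/
def regConjugateSpace (V : Submodule ℂ (ℂ → ℂ)) : Submodule ℂ (ℂ → ℂ) :=
  Submodule.span ℂ {g | ∃ f ∈ conjugateSpace V,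
    g = fun x => f x * ∏ᶠ z ∈ singularPoints V, ((x - z) ^ poleOrder V z)⁻¹}

/-- The space bispectral dual to `V`, spanned by the functions `u ↦ ∮ e^{ux} f(x) dx`, where `f`
is in the regularized conjugate space and the integral is over a circle around a singular point
of `V` that has all the other singular points of `V` outside. -/
def dualSpace (V : Submodule ℂ (ℂ → ℂ)) : Submodule ℂ (ℂ → ℂ) :=
  Submodule.span ℂ {g | ∃ z ∈ singularPoints V, ∃ f ∈ regConjugateSpace V, ∃ r : ℝ, 0 < r ∧
    (∀ w ∈ singularPoints V, w ≠ z → r < dist w z) ∧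
    g = fun u => ∮ x in C(z, r), Complex.exp (u * x) * f x}

/-! ### Spaces of quasi-polynomials -/

/-- The linear map sending a polynomial `p` to the function `x ↦ p(x) e^{lx}`. -/
def expPoly (l : ℂ) : ℂ[X] →ₗ[ℂ] (ℂ → ℂ) where
  toFun p := fun x => p.eval x * Complex.exp (l * x)
  map_add' p q := by
    funext x
    simp [add_mul]
  map_smul' c p := by
    funext x
    simp [mul_assoc]

/-- `V` is a space of quasi-polynomials: it is spanned by functions `p_{ij}(x) e^{λ_i x}`,
`i = 1, …, n`, `j = 1, …, N_i`, with distinct `λ_i` and `0 < deg p_{i1} < … < deg p_{iN_i}`. -/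
def IsQuasiPolynomialSpace (V : Submodule ℂ (ℂ → ℂ)) : Prop :=
  ∃ (n : ℕ) (l : Fin n → ℂ) (N : Fin n → ℕ) (p : (i : Fin n) → Fin (N i) → ℂ[X]),
    0 < n ∧ Function.Injective l ∧ (∀ i, 0 < N i) ∧
    (∀ i j, 0 < (p i j).natDegree) ∧ (∀ i, StrictMono fun j => (p i j).natDegree) ∧
    V = Submodule.span ℂ {g | ∃ i j, g = expPoly (l i) (p i j)}

/-! ### The Grassmannian of admissible subspaces -/

/-- `W` is admissible at `l`: it contains `(t - l)ᵐ ℂ[t]` for some `m`, and an element which does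
not vanish at `l`. -/
def IsAdmissibleAt (l : ℂ) (W : Submodule ℂ ℂ[X]) : Prop :=
  (∃ m : ℕ, ∀ q : ℂ[X], (X - C l) ^ m * q ∈ W) ∧ ∃ f ∈ W, f.eval l ≠ 0

/-- The Grassmannian of admissible subspaces of `ℂ[t]`: finite intersections of subspaces
admissible at distinct points. -/
def Gr : Set (Submodule ℂ ℂ[X]) :=
  {W | ∃ (n : ℕ) (l : Fin n → ℂ) (Wl : Fin n → Submodule ℂ ℂ[X]),
    0 < n ∧ Function.Injective l ∧ (∀ i, IsAdmissibleAt (l i) (Wl i)) ∧ W = ⨅ i, Wl i}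

/-- For `p = ∑ c_a xᵃ`, the linear form `r ↦ ∑ c_a r⁽ᵃ⁾(l)` on `ℂ[t]`. -/
def condition (l : ℂ) (p : ℂ[X]) : ℂ[X] →ₗ[ℂ] ℂ :=
  ∑ a ∈ Finset.range (p.natDegree + 1),
    p.coeff a • (Polynomial.leval l ∘ₗ (Polynomial.derivative ^ a : Module.End ℂ ℂ[X]))

/-- The subspace of `ℂ[t]` corresponding to a space of quasi-polynomials `V`: every element
`p(x) e^{lx}` of `V`, with `p = ∑ c_a xᵃ`, imposes the equation `∑ c_a r⁽ᵃ⁾(l) = 0`. -/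
def subspaceOf (V : Submodule ℂ (ℂ → ℂ)) : Submodule ℂ ℂ[X] :=
  ⨅ (l : ℂ) (p : ℂ[X]) (_ : expPoly l p ∈ V), LinearMap.ker (condition l p)

/-- The space of quasi-polynomials associated with a subspace `W` of `ℂ[t]`, spanned by the
functions `p(x) e^{lx}`, with `p = ∑ c_a xᵃ`, such that the equation `∑ c_a r⁽ᵃ⁾(l) = 0` holds for
all `r` in `W`. -/
def quasiPolySpaceOf (W : Submodule ℂ ℂ[X]) : Submodule ℂ (ℂ → ℂ) :=
  Submodule.span ℂ {g | ∃ (l : ℂ) (p : ℂ[X]), W ≤ LinearMap.ker (condition l p) ∧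
    g = expPoly l p}

/-! ### The stationary Baker–Akhiezer function -/

/-- The number of basis functions of the form `p(x) e^{lx}` in a space of quasi-polynomials
`V`, that is, the dimension of the space of polynomials `p` with `p(x) e^{lx}` in `V`. -/
def multiplicity (V : Submodule ℂ (ℂ → ℂ)) (l : ℂ) : ℕ :=
  Module.finrank ℂ (V.comap (expPoly l))

/-- The stationary Baker–Akhiezer function
`Ψ_W(x, ξ) = ∏ (ξ - λ_i)^(-N_i) · D̄_V e^{xξ}`, where `V` is the space of quasi-polynomials
associated with `W`. -/
def bakerAkhiezer (W : Submodule ℂ ℂ[X]) (x ξ : ℂ) : ℂ :=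
  (∏ᶠ l : ℂ, (ξ - l) ^ multiplicity (quasiPolySpaceOf W) l)⁻¹ *
    monicOperator (quasiPolySpaceOf W) (fun y => Complex.exp (y * ξ)) x

/-- The points `(x, ξ)` at which the meromorphic function `Ψ_W` is given by its defining formula:
`x` is not a singular point of the space of quasi-polynomials `V` associated with `W`, and `ξ` is
not one of the `λ_i`. For admissible `W` this excludes finitely many `x` and finitely many `ξ`. -/
def bakerAkhiezerDomain (W : Submodule ℂ ℂ[X]) : Set (ℂ × ℂ) :=
  {q | q.1 ∉ singularPoints (quasiPolySpaceOf W) ∧ multiplicity (quasiPolySpaceOf W) q.2 = 0}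

/-- `W` and `Y` are bispectral dual with respect to their Baker–Akhiezer functions:
`Ψ_Y(x, ξ) = Ψ_W(ξ, x)` as meromorphic functions, i.e. wherever both sides are defined. -/
def IsBispectralDual (W Y : Submodule ℂ ℂ[X]) : Prop :=
  ∀ x ξ : ℂ, (x, ξ) ∈ bakerAkhiezerDomain Y → (ξ, x) ∈ bakerAkhiezerDomain W →
    bakerAkhiezer Y x ξ = bakerAkhiezer W ξ x

end

end Bispectral

/-!
The Lagrange identity writes `g · D̄_V y`, for `g` a quotient `Wr(f_1, …, f_{N-1}) / Wr_V`, as a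
derivative, so its integral over a circle avoiding the singular points vanishes for every entire
`y`. Let `P = ∏ (x - z_a)^{M_a}` be the polynomial clearing the denominators of `D̄_V`. Taking
`y = e^{ux}` and replacing `x` by `∂_u` turns `P · D̄_V` into an operator in `u` which annihilates
`U`. As `D̄_V` tends to `∏ (∂ - λ_i)^{N_i}` at infinity, this operator has order `deg P = ∑ M_a` and
leading coefficient `∏ (u - λ_i)^{N_i}`.

It remains to see that `dim U = ∑ M_a`. The quotients `g` form a space of dimension `N`, and their
orders at `z_a` are at most `N - 1`. As `D̄_V` is Fuchsian, `M_a ≤ N`, so the functions `g / P`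
without pole at `z_a`, which are those with zero transform at `z_a`, have orders in
`[0, N - M_a)` and form a space of dimension at most `N - M_a`. Hence `U` contains `M_a` independent
functions of frequency `z_a`. The operator above, divided by its leading coefficient, is therefore
`D̄_U`, and `Ψ_Y(x, ξ)` and `Ψ_W(ξ, x)` are the same double sum `∑ A_{kj} x^k ξ^j`, where
`P · D̄_V = ∑ A_{kj} x^j ∂^k`, times `e^{xξ} / (∏ (x - λ_i)^{N_i} ∏ (ξ - z_a)^{M_a})`.
-/

namespace Bispectral

open Polynomial Topology Filter

/-! ### Entire functions -/

/-- The space of entire functions, on which all derivatives are defined without side conditions;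
every space of quasi-polynomials is a subspace of it. -/
def entire : Submodule ℂ (ℂ → ℂ) where
  carrier := {f | Differentiable ℂ f}
  add_mem' hf hg := hf.add hg
  zero_mem' := differentiable_const 0
  smul_mem' c _ hf := hf.const_smul c

theorem mem_entire {f : ℂ → ℂ} : f ∈ entire ↔ Differentiable ℂ f := Iff.rfl

/-- Differentiation as an endomorphism of the space of entire functions. -/
noncomputable def entireDeriv : Module.End ℂ entire where
  toFun f := ⟨deriv f, (mem_entire.1 f.2).deriv⟩
  map_add' f g := Subtype.ext <| funext fun x => deriv_add (f.2 x) (g.2 x)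
  map_smul' c f := Subtype.ext <| funext fun x => deriv_const_smul c (f.2 x)

theorem coe_entireDeriv_pow (n : ℕ) (f : entire) :
    ((entireDeriv ^ n) f : ℂ → ℂ) = iteratedDeriv n f := by
  induction n with
  | zero => rfl
  | succ n ih =>
    rw [pow_succ', Module.End.mul_apply, iteratedDeriv_succ, ← ih]
    rfl

theorem iteratedDeriv_mem_entire {f : ℂ → ℂ} (hf : f ∈ entire) (n : ℕ) :
    iteratedDeriv n f ∈ entire :=
  coe_entireDeriv_pow n ⟨f, hf⟩ ▸ ((entireDeriv ^ n) ⟨f, hf⟩).2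

theorem hasDerivAt_iteratedDeriv {f : ℂ → ℂ} (hf : f ∈ entire) (n : ℕ) (x : ℂ) :
    HasDerivAt (iteratedDeriv n f) (iteratedDeriv (n + 1) f x) x := by
  rw [iteratedDeriv_succ]
  exact (mem_entire.1 (iteratedDeriv_mem_entire hf n) x).hasDerivAt

theorem iteratedDeriv_sum_smul {ι : Type*} [Fintype ι] (c : ι → ℂ) {f : ι → ℂ → ℂ}
    (hf : ∀ i, f i ∈ entire) (n : ℕ) (x : ℂ) :
    iteratedDeriv n (∑ i, c i • f i) x = ∑ i, c i * iteratedDeriv n (f i) x := by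
  have h := coe_entireDeriv_pow n (∑ i, c i • ⟨f i, hf i⟩)
  rw [map_sum] at h
  simpa [coe_entireDeriv_pow] using (congrFun h x).symm

/-- The linear form `r ↦ (r(∂) f)(0)` on polynomials attached to an entire function `f`. For
`f = p(x) e^{lx}` it is `condition l p`. -/
noncomputable def diffPairing : entire →ₗ[ℂ] ℂ[X] →ₗ[ℂ] ℂ :=
  (aeval entireDeriv).toLinearMap.flip.compr₂ (LinearMap.proj 0 ∘ₗ entire.subtype)

theorem diffPairing_X_pow (f : entire) (n : ℕ) :
    diffPairing f (X ^ n) = iteratedDeriv n (f : ℂ → ℂ) 0 := by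
  rw [← coe_entireDeriv_pow]
  simp [diffPairing]

theorem diffPairing_injective : Function.Injective diffPairing := by
  refine (injective_iff_map_eq_zero _).2 fun f hf => Subtype.ext <| funext fun z => ?_
  have hcoeff (n : ℕ) : iteratedDeriv n (f : ℂ → ℂ) 0 = 0 := by
    rw [← diffPairing_X_pow, hf, LinearMap.zero_apply]
  rw [← Complex.taylorSeries_eq_of_entire (mem_entire.1 f.2) 0 z]
  simp [hcoeff]

/-! ### Quasi-polynomials and the conditions they impose -/

/-- The operator `p ↦ p' + l p`, which corresponds to differentiation of `p(x) e^{lx}`. -/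
noncomputable def twistedDeriv (l : ℂ) : Module.End ℂ ℂ[X] := derivative + l • 1

theorem hasDerivAt_expPoly (l : ℂ) (p : ℂ[X]) (x : ℂ) :
    HasDerivAt (expPoly l p) (expPoly l (twistedDeriv l p) x) x := by
  have hexp : HasDerivAt (fun x : ℂ => Complex.exp (l * x)) (Complex.exp (l * x) * (l * 1)) x :=
    ((hasDerivAt_id x).const_mul l).cexp
  convert! (p.hasDerivAt x).mul hexp using 1
  simp only [expPoly, twistedDeriv, LinearMap.add_apply, LinearMap.smul_apply, Module.End.one_apply,
    LinearMap.coe_mk, AddHom.coe_mk, eval_add, eval_smul, smul_eq_mul]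
  ring

theorem expPoly_mem_entire (l : ℂ) (p : ℂ[X]) : expPoly l p ∈ entire :=
  fun x => (hasDerivAt_expPoly l p x).differentiableAt

theorem expPoly_injective (l : ℂ) : Function.Injective (expPoly l) := by
  refine (injective_iff_map_eq_zero _).2 fun p hp => Polynomial.funext fun x => ?_
  simpa [expPoly, Complex.exp_ne_zero] using congrFun hp x

/-- `expPoly` with values in the space of entire functions. -/
noncomputable def entireExpPoly (l : ℂ) : ℂ[X] →ₗ[ℂ] entire :=
  (expPoly l).codRestrict entire (expPoly_mem_entire l)

theorem entireDeriv_entireExpPoly (l : ℂ) (p : ℂ[X]) :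
    entireDeriv (entireExpPoly l p) = entireExpPoly l (twistedDeriv l p) :=
  Subtype.ext <| funext fun x => (hasDerivAt_expPoly l p x).deriv

theorem iteratedDeriv_expPoly (l : ℂ) (p : ℂ[X]) (n : ℕ) :
    iteratedDeriv n (expPoly l p) = expPoly l ((twistedDeriv l ^ n) p) := by
  change iteratedDeriv n (entireExpPoly l p : ℂ → ℂ) = (entireExpPoly l _ : ℂ → ℂ)
  rw [← coe_entireDeriv_pow]
  congr 1
  induction n with
  | zero => rfl
  | succ n ih =>
    rw [pow_succ', pow_succ', Module.End.mul_apply, Module.End.mul_apply, ih,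
      entireDeriv_entireExpPoly]

theorem condition_apply (l : ℂ) (p r : ℂ[X]) :
    condition l p r = p.sum fun a c => c * (derivative^[a] r).eval l := by
  rw [Polynomial.sum_over_range _ (by simp)]
  simp [condition, Polynomial.leval, Module.End.pow_apply]

theorem condition_add (l : ℂ) (p q : ℂ[X]) :
    condition l (p + q) = condition l p + condition l q := by
  ext r
  simp only [LinearMap.comp_apply, LinearMap.add_apply, condition_apply]
  exact Polynomial.sum_add_index _ _ _ (by simp) (by intros; ring)

theorem condition_X_mul (l : ℂ) (p r : ℂ[X]) :
    condition l p (X * r) = condition l (twistedDeriv l p) r := by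
  induction p using Polynomial.induction_on' with
  | add p q hp hq => simp only [map_add, condition_add, LinearMap.add_apply, hp, hq]
  | monomial n c =>
    rw [twistedDeriv, LinearMap.add_apply, condition_add, derivative_monomial,
      LinearMap.smul_apply, Module.End.one_apply, smul_monomial]
    simp only [LinearMap.add_apply, condition_apply]
    rw [Polynomial.sum_monomial_index _ _ (by simp), Polynomial.sum_monomial_index _ _ (by simp),
      Polynomial.sum_monomial_index _ _ (by simp), mul_comm X r,
      Polynomial.iterate_derivative_mul_X]
    simp only [eval_add, eval_mul, eval_X, nsmul_eq_mul, eval_natCast, smul_eq_mul]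
    ring

theorem condition_one (l : ℂ) (p : ℂ[X]) : condition l p 1 = p.eval 0 := by
  induction p using Polynomial.induction_on' with
  | add p q hp hq => simp [condition_add, hp, hq]
  | monomial n c =>
    rw [condition_apply, Polynomial.sum_monomial_index _ _ (by simp)]
    cases n <;> simp [Polynomial.iterate_derivative_one]

theorem condition_X_pow (l : ℂ) (p : ℂ[X]) (n : ℕ) :
    condition l p (X ^ n) = ((twistedDeriv l ^ n) p).eval 0 := by
  induction n generalizing p with
  | zero => simpa using condition_one l p
  | succ n ih => rw [pow_succ', condition_X_mul, ih, pow_succ, Module.End.mul_apply]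

theorem condition_eq_diffPairing (l : ℂ) (p : ℂ[X]) :
    condition l p = diffPairing (entireExpPoly l p) := by
  refine Polynomial.lhom_ext' fun n => LinearMap.ext_ring ?_
  rw [LinearMap.comp_apply, LinearMap.comp_apply, monomial_one_right_eq_X_pow, diffPairing_X_pow,
    condition_X_pow]
  change _ = iteratedDeriv n (expPoly l p) 0
  rw [iteratedDeriv_expPoly]
  simp [expPoly]

theorem condition_X_sub_C_pow_mul (l : ℂ) (p q : ℂ[X]) {m : ℕ} (hm : p.natDegree < m) :
    condition l p ((X - C l) ^ m * q) = 0 := by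
  rw [condition_apply, Polynomial.sum_over_range _ (by simp)]
  refine Finset.sum_eq_zero fun a ha => ?_
  have ha' : m - a ≠ 0 := by
    have := Finset.mem_range.1 ha
    omega
  obtain ⟨s, hs⟩ : (X - C l) ^ (m - a) ∣ derivative^[a] ((X - C l) ^ m * q) :=
    Polynomial.pow_sub_dvd_iterate_derivative_of_pow_dvd a (dvd_mul_right _ _)
  simp [hs, ha']

theorem condition_eq_sum_smul_iff {ι : Type*} [Fintype ι] {l₀ : ℂ} {q : ℂ[X]} {l : ι → ℂ}
    {p : ι → ℂ[X]} {c : ι → ℂ} :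
    condition l₀ q = ∑ a, c a • condition (l a) (p a) ↔
      expPoly l₀ q = ∑ a, c a • expPoly (l a) (p a) := by
  simp only [condition_eq_diffPairing, ← map_smul, ← map_sum]
  rw [diffPairing_injective.eq_iff, ← Subtype.coe_injective.eq_iff]
  simp [entireExpPoly]

theorem expPoly_mem_span_of_iInf_ker_condition_le {ι : Type*} [Finite ι] {l₀ : ℂ} {q : ℂ[X]}
    {l : ι → ℂ} {p : ι → ℂ[X]}
    (h : ⨅ a, LinearMap.ker (condition (l a) (p a)) ≤ LinearMap.ker (condition l₀ q)) :
    expPoly l₀ q ∈ Submodule.span ℂ (Set.range fun a => expPoly (l a) (p a)) := by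
  have := Fintype.ofFinite ι
  obtain ⟨c, hc⟩ := (Submodule.mem_span_range_iff_exists_fun ℂ).1 (mem_span_of_iInf_ker_le_ker h)
  exact (Submodule.mem_span_range_iff_exists_fun ℂ).2
    ⟨c, (condition_eq_sum_smul_iff.1 hc.symm).symm⟩

theorem subspaceOf_span {ι : Type*} [Finite ι] (l : ι → ℂ) (p : ι → ℂ[X]) :
    subspaceOf (Submodule.span ℂ (Set.range fun a => expPoly (l a) (p a))) =
      ⨅ a, LinearMap.ker (condition (l a) (p a)) := by
  have := Fintype.ofFinite ι
  refine le_antisymm (le_iInf fun a => ?_)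
    (le_iInf fun m => le_iInf fun q => le_iInf fun hq => ?_)
  · exact iInf_le_of_le (l a) <| iInf_le_of_le (p a) <|
      iInf_le _ (Submodule.subset_span (Set.mem_range_self a))
  · obtain ⟨c, hc⟩ := (Submodule.mem_span_range_iff_exists_fun ℂ).1 hq
    rw [condition_eq_sum_smul_iff.2 hc.symm]
    intro r hr
    rw [Submodule.mem_iInf] at hr
    rw [LinearMap.mem_ker, LinearMap.sum_apply]
    exact Finset.sum_eq_zero fun a _ => by
      rw [LinearMap.smul_apply, LinearMap.mem_ker.1 (hr a), smul_zero]

theorem quasiPolySpaceOf_subspaceOf_span {ι : Type*} [Finite ι] (l : ι → ℂ) (p : ι → ℂ[X]) :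
    quasiPolySpaceOf (subspaceOf (Submodule.span ℂ (Set.range fun a => expPoly (l a) (p a)))) =
      Submodule.span ℂ (Set.range fun a => expPoly (l a) (p a)) := by
  rw [subspaceOf_span]
  refine le_antisymm (Submodule.span_le.2 ?_) (Submodule.span_le.2 ?_)
  · rintro _ ⟨m, q, hle, rfl⟩
    exact expPoly_mem_span_of_iInf_ker_condition_le hle
  · rintro _ ⟨a, rfl⟩
    exact Submodule.subset_span ⟨_, _, iInf_le _ a, rfl⟩

/-! ### Admissibility -/

theorem sum_smul_ne_one_of_natDegree_strictMono {R : Type*} [Ring R] [IsDomain R] {n : ℕ}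
    {p : Fin n → R[X]} (hpos : ∀ j, 0 < (p j).natDegree)
    (hmono : StrictMono fun j => (p j).natDegree) (c : Fin n → R) : ∑ j, c j • p j ≠ 1 := by
  classical
  intro h
  obtain ⟨j₀, hj₀⟩ : ∃ j, c j ≠ 0 := by
    by_contra! hc
    simp [hc] at h
  obtain ⟨j, hj, hmax⟩ := (Finset.univ.filter fun j => c j ≠ 0).exists_max_image id
    ⟨j₀, by simpa using hj₀⟩
  have hcoeff := congrArg (fun q => q.coeff (p j).natDegree) h
  simp only [finsetSum_coeff, coeff_smul, coeff_one, (hpos j).ne', if_false] at hcoeff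
  rw [Finset.sum_eq_single j] at hcoeff
  · have hlead : (p j).leadingCoeff ≠ 0 :=
      leadingCoeff_ne_zero.2 fun h0 => by simpa [h0] using hpos j
    exact mul_ne_zero (by simpa using hj) hlead hcoeff
  · intro i _ hij
    by_cases hi : c i = 0
    · simp [hi]
    · have hlt : i < j := lt_of_le_of_ne (hmax i (by simpa using hi)) hij
      rw [coeff_eq_zero_of_natDegree_lt (hmono hlt), smul_zero]
  · simp

theorem isAdmissibleAt_iInf_ker_condition (l : ℂ) {n : ℕ} {p : Fin n → ℂ[X]}
    (hpos : ∀ j, 0 < (p j).natDegree) (hmono : StrictMono fun j => (p j).natDegree) :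
    IsAdmissibleAt l (⨅ j, LinearMap.ker (condition l (p j))) := by
  refine ⟨⟨(∑ j, (p j).natDegree) + 1, fun q => ?_⟩, ?_⟩
  · refine Submodule.mem_iInf _ |>.2 fun j => condition_X_sub_C_pow_mul _ _ _ ?_
    exact Nat.lt_succ_of_le <| Finset.single_le_sum (f := fun j => (p j).natDegree)
      (fun _ _ => Nat.zero_le _) (Finset.mem_univ j)
  · -- If all elements vanish at `l`, the condition `r(l) = 0`, which is that of the polynomial
    -- `1`, follows from the others, so `1` is a combination of polynomials of positive degree.
    by_contra! hvanish
    have hle : ⨅ j, LinearMap.ker (condition l (p j)) ≤ LinearMap.ker (condition l 1) :=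
      fun r hr => by
        rw [LinearMap.mem_ker, condition_apply, ← C_1, Polynomial.sum_C_index (by simp)]
        simpa using hvanish r hr
    obtain ⟨c, hc⟩ := (Submodule.mem_span_range_iff_exists_fun ℂ).1
      (expPoly_mem_span_of_iInf_ker_condition_le hle)
    refine sum_smul_ne_one_of_natDegree_strictMono hpos hmono c (expPoly_injective l ?_)
    rw [← hc, map_sum]
    simp only [map_smul]

theorem setOf_expPoly_eq_range {n : ℕ} {N : Fin n → ℕ} (l : Fin n → ℂ)
    (p : (i : Fin n) → Fin (N i) → ℂ[X]) :
    {g | ∃ i j, g = expPoly (l i) (p i j)} =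
      Set.range fun ij : Σ i, Fin (N i) => expPoly (l ij.1) (p ij.1 ij.2) := by
  ext g
  simp [eq_comm]

theorem IsQuasiPolynomialSpace.subspaceOf_mem_Gr {V : Submodule ℂ (ℂ → ℂ)}
    (hV : IsQuasiPolynomialSpace V) : subspaceOf V ∈ Gr := by
  obtain ⟨n, l, N, p, hn, hl, -, hpos, hmono, rfl⟩ := hV
  refine ⟨n, l, fun i => ⨅ j, LinearMap.ker (condition (l i) (p i j)), hn, hl,
    fun i => isAdmissibleAt_iInf_ker_condition (l i) (hpos i) (hmono i), ?_⟩
  rw [setOf_expPoly_eq_range, subspaceOf_span, iInf_sigma]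

/-! ### Multiplicities -/

theorem sum_finrank_le_finrank_of_iSupIndep {K M ι : Type*} [Field K] [AddCommGroup M] [Module K M]
    {p : ι → Submodule K M} (hp : iSupIndep p) {U : Submodule K M} [FiniteDimensional K U]
    (hU : ∀ i, p i ≤ U) (s : Finset ι) :
    ∑ i ∈ s, Module.finrank K (p i) ≤ Module.finrank K U := by
  classical
  have hfin (i : ι) : FiniteDimensional K (p i) := Submodule.finiteDimensional_of_le (hU i)
  have hinj := (hp.comp (Subtype.val_injective (p := (· ∈ s)))).dfinsupp_lsum_injective
  rw [← Finset.sum_coe_sort, ← Module.finrank_directSum]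
  refine (LinearMap.finrank_range_of_inj hinj).symm.trans_le (Submodule.finrank_mono ?_)
  rw [← Submodule.iSup_eq_range_dfinsupp_lsum]
  exact iSup_le fun i => hU i

theorem range_entireExpPoly_le_maxGenEigenspace (l : ℂ) :
    LinearMap.range (entireExpPoly l) ≤ entireDeriv.maxGenEigenspace l := by
  rintro _ ⟨p, rfl⟩
  have hpow (m : ℕ) : ((entireDeriv - l • 1) ^ m) (entireExpPoly l p) =
      entireExpPoly l (derivative^[m] p) := by
    induction m with
    | zero => rfl
    | succ m ih =>
      rw [pow_succ', Module.End.mul_apply, ih, LinearMap.sub_apply, entireDeriv_entireExpPoly,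
        Function.iterate_succ_apply']
      simp [twistedDeriv]
  refine Module.End.mem_maxGenEigenspace _ _ _ |>.2 ⟨p.natDegree + 1, ?_⟩
  rw [hpow, iterate_derivative_eq_zero (Nat.lt_succ_self _), map_zero]

theorem iSupIndep_range_expPoly : iSupIndep fun l => LinearMap.range (expPoly l) := by
  rw [iSupIndep_iff_finsetSum_eq_zero_imp_eq_zero]
  intro S v hv hsum l hl
  choose! p hp using hv
  have hindep := entireDeriv.independent_maxGenEigenspace.mono
    range_entireExpPoly_le_maxGenEigenspace
  rw [iSupIndep_iff_finsetSum_eq_zero_imp_eq_zero] at hindep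
  have hsum' : ∑ l ∈ S, entireExpPoly l (p l) = 0 := Subtype.ext <| by
    rw [AddSubmonoidClass.coe_finsetSum, ZeroMemClass.coe_zero, ← hsum]
    exact Finset.sum_congr rfl hp
  rw [← hp l hl]
  exact congrArg Subtype.val (hindep S _ (fun l _ => LinearMap.mem_range_self _ _) hsum' l hl)

theorem sum_multiplicity_le (U : Submodule ℂ (ℂ → ℂ)) [FiniteDimensional ℂ U] (S : Finset ℂ) :
    ∑ l ∈ S, multiplicity U l ≤ Module.finrank ℂ U := by
  refine le_of_eq_of_le (Finset.sum_congr rfl fun l _ => ?_)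
    (sum_finrank_le_finrank_of_iSupIndep
      (iSupIndep_range_expPoly.mono fun l => LinearMap.map_le_range (p := U.comap (expPoly l)))
      (fun l => Submodule.map_comap_le _ _) S)
  exact (Submodule.equivMapOfInjective _ (expPoly_injective l) _).finrank_eq

theorem multiplicity_eq_of_le {U : Submodule ℂ (ℂ → ℂ)} [FiniteDimensional ℂ U] {m : ℂ → ℕ}
    {S : Finset ℂ} (hm : ∀ l ∈ S, m l ≤ multiplicity U l)
    (hS : Module.finrank ℂ U ≤ ∑ l ∈ S, m l) :
    (∀ l ∈ S, multiplicity U l = m l) ∧ ∀ l ∉ S, multiplicity U l = 0 := by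
  classical
  have hle := Finset.sum_le_sum hm
  refine ⟨fun l hl => ?_, fun l hl => ?_⟩
  · have hsum := sum_multiplicity_le U S
    exact ((Finset.sum_eq_sum_iff_of_le hm).1 (by omega) l hl).symm
  · have hsum := sum_multiplicity_le U (insert l S)
    rw [Finset.sum_insert hl] at hsum
    omega

theorem finprod_sub_pow_multiplicity {U : Submodule ℂ (ℂ → ℂ)} {m : ℂ → ℕ} {S : Finset ℂ}
    (hmem : ∀ l ∈ S, multiplicity U l = m l) (hnotMem : ∀ l ∉ S, multiplicity U l = 0) (ξ : ℂ) :
    ∏ᶠ l : ℂ, (ξ - l) ^ multiplicity U l = ∏ l ∈ S, (ξ - l) ^ m l := by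
  rw [finprod_eq_prod_of_mulSupport_subset (s := S)]
  · exact Finset.prod_congr rfl fun l hl => by rw [hmem l hl]
  · intro l hl
    by_contra hS
    exact hl (by simp [hnotMem l hS])

/-! ### Bases of spaces of entire functions -/

theorem linearIndependent_sum_smul_iff_det_ne_zero {K M ι : Type*} [Field K] [AddCommGroup M]
    [Module K M] [Fintype ι] [DecidableEq ι] {f : ι → M} (hf : LinearIndependent K f)
    (T : Matrix ι ι K) : LinearIndependent K (fun i => ∑ a, T i a • f a) ↔ T.det ≠ 0 := by
  have hsum (c : ι → K) : ∑ i, c i • ∑ a, T i a • f a = ∑ a, (Matrix.vecMul c T) a • f a := by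
    simp only [Matrix.vecMul, dotProduct, Finset.sum_smul, Finset.smul_sum, smul_smul]
    exact Finset.sum_comm
  have hzero (c : ι → K) : ∑ i, c i • ∑ a, T i a • f a = 0 ↔ Matrix.vecMul c T = 0 := by
    rw [hsum]
    exact ⟨fun h => funext (Fintype.linearIndependent_iff.1 hf _ h), fun h => by simp [h]⟩
  rw [Fintype.linearIndependent_iff, ← not_iff_not, not_ne_iff, ← Matrix.exists_vecMul_eq_zero_iff]
  simp only [hzero, not_forall, exists_prop, Function.ne_iff, Pi.zero_apply]
  exact exists_congr fun c => and_comm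

/-- The entire functions `f₀, …, f_{N-1}` form a basis of the space of functions `V`. A predicate
on families is used instead of `Module.Basis` since Wronskians are taken of plain functions and the
length `N` has to be a variable rather than `finrank ℂ V`. -/
structure IsEntireBasis {N : ℕ} (V : Submodule ℂ (ℂ → ℂ)) (f : Fin N → ℂ → ℂ) : Prop where
  mem_entire : ∀ a, f a ∈ entire
  linearIndependent : LinearIndependent ℂ f
  span_eq : Submodule.span ℂ (Set.range f) = V

namespace IsEntireBasis

variable {N : ℕ} {V : Submodule ℂ (ℂ → ℂ)} {f : Fin N → ℂ → ℂ}

theorem mem (h : IsEntireBasis V f) (a : Fin N) : f a ∈ V :=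
  h.span_eq ▸ Submodule.subset_span ⟨a, rfl⟩

theorem mem_iff (h : IsEntireBasis V f) {y : ℂ → ℂ} :
    y ∈ V ↔ ∃ c : Fin N → ℂ, ∑ a, c a • f a = y := by
  rw [← h.span_eq, Submodule.mem_span_range_iff_exists_fun]

theorem finiteDimensional (h : IsEntireBasis V f) : FiniteDimensional ℂ V :=
  h.span_eq ▸ FiniteDimensional.span_of_finite ℂ (Set.finite_range f)

theorem finrank_eq (h : IsEntireBasis V f) : Module.finrank ℂ V = N := by
  rw [← h.span_eq, finrank_span_eq_card h.linearIndependent, Fintype.card_fin]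

theorem le_entire (h : IsEntireBasis V f) : V ≤ entire := by
  rw [← h.span_eq, Submodule.span_le]
  exact Set.range_subset_iff.2 h.mem_entire

theorem of_linearIndependent (h : IsEntireBasis V f) {g : Fin N → ℂ → ℂ} (hg : ∀ a, g a ∈ V)
    (hind : LinearIndependent ℂ g) : IsEntireBasis V g where
  mem_entire a := h.le_entire (hg a)
  linearIndependent := hind
  span_eq := by
    have := h.finiteDimensional
    refine Submodule.eq_of_le_of_finrank_eq (Submodule.span_le.2 (Set.range_subset_iff.2 hg)) ?_
    rw [finrank_span_eq_card hind, Fintype.card_fin, h.finrank_eq]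

theorem sum_smul (h : IsEntireBasis V f) {T : Matrix (Fin N) (Fin N) ℂ} (hT : T.det ≠ 0) :
    IsEntireBasis V fun i => ∑ a, T i a • f a :=
  h.of_linearIndependent (fun _ => h.mem_iff.2 ⟨_, rfl⟩)
    ((linearIndependent_sum_smul_iff_det_ne_zero h.linearIndependent T).2 hT)

theorem exists_matrix {g : Fin N → ℂ → ℂ} (h : IsEntireBasis V f) (hg : IsEntireBasis V g) :
    ∃ T : Matrix (Fin N) (Fin N) ℂ, T.det ≠ 0 ∧ g = fun i => ∑ a, T i a • f a := by
  choose T hT using fun i => h.mem_iff.1 (hg.mem i)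
  have hgT : g = fun i => ∑ a, (Matrix.of T) i a • f a := funext fun i => (hT i).symm
  refine ⟨Matrix.of T, ?_, hgT⟩
  rw [← linearIndependent_sum_smul_iff_det_ne_zero h.linearIndependent, ← hgT]
  exact hg.linearIndependent

theorem linearIndependent_init {m : ℕ} {f : Fin (m + 1) → ℂ → ℂ} (h : IsEntireBasis V f) :
    LinearIndependent ℂ (Fin.init f) :=
  h.linearIndependent.comp _ (Fin.castSucc_injective m)

end IsEntireBasis

theorem isEntireBasis_basisOf {V : Submodule ℂ (ℂ → ℂ)} [FiniteDimensional ℂ V]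
    (hV : V ≤ entire) : IsEntireBasis V (basisOf V) := by
  have hbasis : basisOf V = V.subtype ∘ Module.finBasis ℂ V := by
    rw [basisOf, dif_pos ‹_›]
    rfl
  rw [hbasis]
  refine ⟨fun a => hV (Module.finBasis ℂ V a).2,
    (Module.finBasis ℂ V).linearIndependent.map' V.subtype (Submodule.ker_subtype V), ?_⟩
  rw [Set.range_comp, Submodule.span_image, (Module.finBasis ℂ V).span_eq, Submodule.map_top,
    Submodule.range_subtype]

/-- The quasi-polynomials `p_a(x) e^{l_a x}` form a basis of `V`; the exponents `l_a` are listed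
with repetitions. -/
abbrev IsExpPolyBasis {N : ℕ} (V : Submodule ℂ (ℂ → ℂ)) (l : Fin N → ℂ) (p : Fin N → ℂ[X]) : Prop :=
  IsEntireBasis V fun a => expPoly (l a) (p a)

theorem IsQuasiPolynomialSpace.ne_bot {V : Submodule ℂ (ℂ → ℂ)} (hV : IsQuasiPolynomialSpace V) :
    V ≠ ⊥ := by
  obtain ⟨n, l, N, p, hn, -, hN, hpos, -, rfl⟩ := hV
  refine (Submodule.ne_bot_iff _).2
    ⟨_, Submodule.subset_span ⟨⟨0, hn⟩, ⟨0, hN _⟩, rfl⟩, fun h0 => ?_⟩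
  have hdeg := hpos ⟨0, hn⟩ ⟨0, hN _⟩
  rw [expPoly_injective _ (h0.trans (map_zero _).symm), natDegree_zero] at hdeg
  exact hdeg.false

theorem IsQuasiPolynomialSpace.exists_isExpPolyBasis {V : Submodule ℂ (ℂ → ℂ)}
    (hV : IsQuasiPolynomialSpace V) :
    ∃ (m : ℕ) (l : Fin (m + 1) → ℂ) (p : Fin (m + 1) → ℂ[X]), IsExpPolyBasis V l p := by
  have hne := hV.ne_bot
  obtain ⟨n, l, N, p, -, -, -, -, -, rfl⟩ := hV
  rw [setOf_expPoly_eq_range] at hne ⊢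
  obtain ⟨κ, a, ha, hspan, hind⟩ := exists_linearIndependent' ℂ
    fun ij : Σ i, Fin (N i) => expPoly (l ij.1) (p ij.1 ij.2)
  have := Finite.of_injective a ha
  obtain ⟨M, ⟨e⟩⟩ := Finite.exists_equiv_fin κ
  have hbasis : IsExpPolyBasis
      (Submodule.span ℂ (Set.range fun ij : Σ i, Fin (N i) => expPoly (l ij.1) (p ij.1 ij.2)))
      (fun b => l (a (e.symm b)).1) fun b => p (a (e.symm b)).1 (a (e.symm b)).2 := by
    refine ⟨fun _ => expPoly_mem_entire _ _, hind.comp e.symm e.symm.injective, ?_⟩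
    rw [← hspan, ← e.symm.surjective.range_comp]
    rfl
  cases M with
  | zero =>
    rw [← hbasis.span_eq, Set.range_eq_empty, Submodule.span_empty] at hne
    exact absurd rfl hne
  | succ m => exact ⟨m, _, _, hbasis⟩

namespace IsExpPolyBasis

variable {N : ℕ} {V : Submodule ℂ (ℂ → ℂ)} {l : Fin N → ℂ} {p : Fin N → ℂ[X]}

theorem quasiPolySpaceOf_subspaceOf (h : IsExpPolyBasis V l p) :
    quasiPolySpaceOf (subspaceOf V) = V := by
  rw [← h.span_eq]
  exact quasiPolySpaceOf_subspaceOf_span l p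

theorem card_filter_le_multiplicity [DecidableEq ℂ] (h : IsExpPolyBasis V l p) (m : ℂ) :
    (Finset.univ.filter fun a => l a = m).card ≤ multiplicity V m := by
  have := h.finiteDimensional
  have hfin : FiniteDimensional ℂ (V.comap (expPoly m)) :=
    FiniteDimensional.of_injective ((expPoly m).restrict (p := V.comap (expPoly m)) (q := V)
      fun _ h => h) fun a b hab => Subtype.ext (expPoly_injective m (congrArg Subtype.val hab))
  let v (a : {a // l a = m}) : V.comap (expPoly m) :=
    ⟨p a, by simpa [Submodule.mem_comap, a.2] using h.mem a⟩
  have hcomp : (fun a : {a // l a = m} => expPoly (l a) (p a)) =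
      (expPoly m ∘ₗ (V.comap (expPoly m)).subtype) ∘ v :=
    funext fun a => by simp [v, a.2]
  have hind : LinearIndependent ℂ fun a : {a // l a = m} => expPoly (l a) (p a) :=
    h.linearIndependent.comp _ Subtype.val_injective
  have hv : LinearIndependent ℂ v := by
    rw [hcomp] at hind
    exact LinearIndependent.of_comp _ hind
  simpa [multiplicity, Fintype.card_subtype] using hv.fintype_card_le_finrank

theorem finprod_sub_pow_multiplicity (h : IsExpPolyBasis V l p) (ξ : ℂ) :
    ∏ᶠ m : ℂ, (ξ - m) ^ multiplicity V m = ∏ a, (ξ - l a) := by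
  classical
  have := h.finiteDimensional
  obtain ⟨hmem, hnotMem⟩ := multiplicity_eq_of_le (S := Finset.univ.image l)
    (fun m _ => h.card_filter_le_multiplicity m) <| by
      rw [h.finrank_eq, ← Finset.card_eq_sum_card_image, Finset.card_univ, Fintype.card_fin]
  rw [Bispectral.finprod_sub_pow_multiplicity hmem hnotMem,
    ← Finset.prod_fiberwise_of_maps_to fun a ha => Finset.mem_image_of_mem l ha]
  refine Finset.prod_congr rfl fun m _ => ?_
  rw [Finset.prod_congr rfl (g := fun _ => ξ - m)
    fun a ha => by rw [(Finset.mem_filter.1 ha).2], Finset.prod_const]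

theorem prod_sub_ne_zero (h : IsExpPolyBasis V l p) {x : ℂ} (hx : multiplicity V x = 0) :
    ∏ a, (x - l a) ≠ 0 := by
  classical
  refine Finset.prod_ne_zero_iff.2 fun a _ hxa => ?_
  have hcard := h.card_filter_le_multiplicity x
  rw [hx, Nat.le_zero, Finset.card_eq_zero, Finset.filter_eq_empty_iff] at hcard
  exact hcard (Finset.mem_univ a) (sub_eq_zero.1 hxa).symm

end IsExpPolyBasis

/-! ### Wronskians and monic operators -/

theorem eventually_ne_zero_of_mem_entire {w : ℂ → ℂ} (hw : w ∈ entire) (hne : ∃ x, w x ≠ 0)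
    (z : ℂ) : ∀ᶠ x in 𝓝[≠] z, w x ≠ 0 := by
  obtain ⟨y, hy⟩ := hne
  have han : AnalyticOnNhd ℂ w Set.univ := fun x _ => (mem_entire.1 hw).analyticAt x
  refine Filter.not_frequently.1 fun hzero => hy ?_
  exact han.eqOn_zero_of_preconnected_of_frequently_eq_zero isPreconnected_univ (Set.mem_univ z)
    hzero (Set.mem_univ y)

theorem eq_zero_of_mem_entire_of_eventually {w : ℂ → ℂ} (hw : w ∈ entire) {z : ℂ}
    (h : ∀ᶠ x in 𝓝[≠] z, w x = 0) : w = 0 := by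
  by_contra hne
  obtain ⟨x, hx, hx'⟩ :=
    (h.and (eventually_ne_zero_of_mem_entire hw (Function.ne_iff.1 hne) z)).exists
  exact hx' hx

theorem genWronskian_sum_smul {N : ℕ} {f : Fin N → ℂ → ℂ} (hf : ∀ a, f a ∈ entire)
    (T : Matrix (Fin N) (Fin N) ℂ) (d : Fin N → ℕ) (x : ℂ) :
    genWronskian (fun i => ∑ a, T i a • f a) d x = T.det * genWronskian f d x := by
  rw [genWronskian, genWronskian, ← Matrix.det_mul]
  congr 1
  ext i b
  simp [Matrix.mul_apply, iteratedDeriv_sum_smul _ hf]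

theorem wronskian_sum_smul {N : ℕ} {f : Fin N → ℂ → ℂ} (hf : ∀ a, f a ∈ entire)
    (T : Matrix (Fin N) (Fin N) ℂ) (x : ℂ) :
    wronskian (fun i => ∑ a, T i a • f a) x = T.det * wronskian f x :=
  genWronskian_sum_smul hf T _ x

theorem genWronskian_mem_entire {N : ℕ} {f : Fin N → ℂ → ℂ} (hf : ∀ a, f a ∈ entire)
    (d : Fin N → ℕ) : genWronskian f d ∈ entire := by
  have hdet : genWronskian f d = fun x => ∑ σ : Equiv.Perm (Fin N), (Equiv.Perm.sign σ : ℂ) *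
      ∏ i, iteratedDeriv (d i) (f (σ i)) x :=
    funext fun x => Matrix.det_apply' _
  rw [hdet]
  refine mem_entire.2 (Differentiable.fun_sum fun σ _ => Differentiable.const_mul ?_ _)
  exact Differentiable.fun_finsetProd fun i _ => iteratedDeriv_mem_entire (hf _) _

theorem wronskian_mem_entire {N : ℕ} {f : Fin N → ℂ → ℂ} (hf : ∀ a, f a ∈ entire) :
    wronskian f ∈ entire := genWronskian_mem_entire hf _

/-- The coefficient of `∂ᵏ` in the monic operator of order `N` annihilating `f₁, …, f_N`. It is the
`monicCoeff` of their span, with `N` in place of a `finrank`. -/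
noncomputable def opCoeff {N : ℕ} (f : Fin N → ℂ → ℂ) (k : Fin (N + 1)) (x : ℂ) : ℂ :=
  (-1) ^ (N - (k : ℕ)) * genWronskian f (fun b => ((k.succAbove b : Fin (N + 1)) : ℕ)) x /
    wronskian f x

/-- The monic operator annihilating `f₁, …, f_N`, applied to `g`. -/
noncomputable def monicOp {N : ℕ} (f : Fin N → ℂ → ℂ) (g : ℂ → ℂ) (x : ℂ) : ℂ :=
  ∑ k : Fin (N + 1), opCoeff f k x * iteratedDeriv (k : ℕ) g x

section Wronskian

variable {N : ℕ} {f : Fin N → ℂ → ℂ} {g : ℂ → ℂ} {x : ℂ}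

theorem opCoeff_sum_smul (hf : ∀ a, f a ∈ entire) {T : Matrix (Fin N) (Fin N) ℂ} (hT : T.det ≠ 0) :
    opCoeff (fun i => ∑ a, T i a • f a) = opCoeff f := by
  funext k x
  rw [opCoeff, opCoeff, wronskian_sum_smul hf, genWronskian_sum_smul hf, mul_left_comm,
    mul_div_mul_left _ _ hT]

theorem wronskian_snoc (f : Fin N → ℂ → ℂ) (g : ℂ → ℂ) (x : ℂ) :
    wronskian (Fin.snoc f g : Fin (N + 1) → ℂ → ℂ) x = ∑ k : Fin (N + 1),
      (-1) ^ (N - (k : ℕ)) * genWronskian f (fun b => ((k.succAbove b : Fin (N + 1)) : ℕ)) x *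
        iteratedDeriv (k : ℕ) g x := by
  rw [wronskian, genWronskian, Matrix.det_succ_row _ (Fin.last N)]
  refine Finset.sum_congr rfl fun k _ => ?_
  have hsign : ((-1 : ℂ)) ^ (N + (k : ℕ)) = (-1) ^ (N - (k : ℕ)) := by
    rw [show N + (k : ℕ) = (N - k) + 2 * k by omega, pow_add, pow_mul]
    simp
  have hminor : (Matrix.submatrix (Matrix.of fun a b : Fin (N + 1) =>
      iteratedDeriv (b : ℕ) ((Fin.snoc f g : Fin (N + 1) → ℂ → ℂ) a) x)
      (Fin.last N).succAbove k.succAbove) = Matrix.of fun a b : Fin N =>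
        iteratedDeriv ((k.succAbove b : Fin (N + 1)) : ℕ) (f a) x := by
    ext a b
    simp
  rw [hminor, Fin.val_last, hsign, genWronskian, Matrix.of_apply, Fin.snoc_last]
  ring

theorem monicOp_eq_wronskian_snoc_div (f : Fin N → ℂ → ℂ) (g : ℂ → ℂ) (x : ℂ) :
    monicOp f g x = wronskian (Fin.snoc f g : Fin (N + 1) → ℂ → ℂ) x / wronskian f x := by
  rw [wronskian_snoc, Finset.sum_div]
  exact Finset.sum_congr rfl fun k _ => by rw [opCoeff]; ring

theorem monicOp_self (f : Fin N → ℂ → ℂ) (a : Fin N) (x : ℂ) : monicOp f (f a) x = 0 := by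
  rw [monicOp_eq_wronskian_snoc_div, wronskian, genWronskian,
    Matrix.det_zero_of_row_eq (i := a.castSucc) (j := Fin.last N) (Fin.castSucc_lt_last a).ne,
    zero_div]
  ext b
  simp

theorem opCoeff_last (hx : wronskian f x ≠ 0) : opCoeff f (Fin.last N) x = 1 := by
  simpa [opCoeff, wronskian] using div_self hx

theorem monicOp_eq_sum_add (hx : wronskian f x ≠ 0) (g : ℂ → ℂ) :
    monicOp f g x = ∑ b : Fin N, opCoeff f b.castSucc x * iteratedDeriv (b : ℕ) g x +
      iteratedDeriv N g x := by
  simp [monicOp, Fin.sum_univ_castSucc, opCoeff_last hx]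

theorem eq_zero_of_sum_mul_iteratedDeriv (hx : wronskian f x ≠ 0) {c : Fin N → ℂ}
    (h : ∀ a, ∑ b : Fin N, c b * iteratedDeriv (b : ℕ) (f a) x = 0) : c = 0 := by
  refine Matrix.eq_zero_of_mulVec_eq_zero hx (funext fun a => ?_)
  rw [Pi.zero_apply, ← h a]
  simp [Matrix.mulVec, dotProduct, mul_comm]

theorem eq_zero_of_forall_sum_mul_iteratedDeriv (hx : wronskian f x ≠ 0) {c : Fin N → ℂ}
    (h : ∀ b : Fin N, ∑ a, c a * iteratedDeriv (b : ℕ) (f a) x = 0) : c = 0 := by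
  refine Matrix.eq_zero_of_vecMul_eq_zero hx (funext fun b => ?_)
  rw [Pi.zero_apply, ← h b]
  simp [Matrix.vecMul, dotProduct]

theorem opCoeff_eq_of_sum_mul_iteratedDeriv (hx : wronskian f x ≠ 0) {c : Fin (N + 1) → ℂ}
    (hc : c (Fin.last N) = 1)
    (h : ∀ a, ∑ k : Fin (N + 1), c k * iteratedDeriv (k : ℕ) (f a) x = 0) (k : Fin (N + 1)) :
    opCoeff f k x = c k := by
  have hdiff : (fun b : Fin N => c b.castSucc - opCoeff f b.castSucc x) = 0 := by
    refine eq_zero_of_sum_mul_iteratedDeriv hx fun a => ?_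
    have hself := monicOp_self f a x
    rw [monicOp_eq_sum_add hx] at hself
    have ha := h a
    rw [Fin.sum_univ_castSucc, hc] at ha
    simp only [Fin.val_castSucc, Fin.val_last] at ha
    simp only [sub_mul, Finset.sum_sub_distrib]
    linear_combination ha - hself
  induction k using Fin.lastCases with
  | last => rw [hc, opCoeff_last hx]
  | cast b => exact (sub_eq_zero.1 (congrFun hdiff b)).symm

/-! ### Linear independence and the Wronskian -/

/-- The solutions of the linear system `∑ₐ cₐ fₐ⁽ᵇ⁾(x) = g⁽ᵇ⁾(x)`, `b < N`, by Cramer's rule. -/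
noncomputable def cramerCoeff (f : Fin N → ℂ → ℂ) (g : ℂ → ℂ) (a : Fin N) (x : ℂ) : ℂ :=
  wronskian (Function.update f a g) x / wronskian f x

theorem sum_cramerCoeff_mul_iteratedDeriv (hx : wronskian f x ≠ 0) (g : ℂ → ℂ) (b : Fin N) :
    ∑ a, cramerCoeff f g a x * iteratedDeriv (b : ℕ) (f a) x = iteratedDeriv (b : ℕ) g x := by
  let M : Matrix (Fin N) (Fin N) ℂ := Matrix.of fun a b : Fin N => iteratedDeriv (b : ℕ) (f a) x
  have hupdate (a : Fin N) : M.transpose.cramer (fun b => iteratedDeriv (b : ℕ) g x) a =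
      wronskian (Function.update f a g) x := by
    rw [Matrix.cramer_transpose_apply, wronskian, genWronskian]
    congr 1
    ext i j
    obtain rfl | hi := eq_or_ne i a
    · simp
    · simp [hi, M]
  have hcramer := congrFun (Matrix.mulVec_cramer M.transpose fun b => iteratedDeriv (b : ℕ) g x) b
  simp only [Matrix.mulVec, dotProduct, hupdate, Pi.smul_apply, smul_eq_mul, Matrix.det_transpose]
    at hcramer
  rw [eq_comm, ← mul_right_inj' hx]
  refine hcramer.symm.trans ?_
  rw [Finset.mul_sum]
  refine Finset.sum_congr rfl fun a _ => ?_
  rw [cramerCoeff, ← mul_assoc, mul_div_cancel₀ _ hx, mul_comm]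
  rfl

theorem sum_cramerCoeff_mul_iteratedDeriv_of_monicOp_eq_zero (hx : wronskian f x ≠ 0)
    (hg : monicOp f g x = 0) {b : ℕ} (hb : b ≤ N) :
    ∑ a, cramerCoeff f g a x * iteratedDeriv b (f a) x = iteratedDeriv b g x := by
  obtain hb | rfl := hb.lt_or_eq
  · exact sum_cramerCoeff_mul_iteratedDeriv hx g ⟨b, hb⟩
  have hself : ∑ a, cramerCoeff f g a x * monicOp f (f a) x = 0 := by simp [monicOp_self]
  simp only [monicOp_eq_sum_add hx, mul_add, Finset.sum_add_distrib, Finset.mul_sum,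
    mul_left_comm (cramerCoeff f g _ x)] at hself
  rw [Finset.sum_comm] at hself
  simp only [← Finset.mul_sum, sum_cramerCoeff_mul_iteratedDeriv hx] at hself
  rw [monicOp_eq_sum_add hx] at hg
  linear_combination hself - hg

theorem differentiableAt_cramerCoeff (hf : ∀ a, f a ∈ entire) (hg : g ∈ entire)
    (hx : wronskian f x ≠ 0) (a : Fin N) : DifferentiableAt ℂ (cramerCoeff f g a) x := by
  refine DifferentiableAt.div (wronskian_mem_entire (fun i => ?_) x) (wronskian_mem_entire hf x) hx
  obtain rfl | hi := eq_or_ne i a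
  · simpa using hg
  · simpa [hi] using hf i

theorem deriv_cramerCoeff_eq_zero (hf : ∀ a, f a ∈ entire) (hg : g ∈ entire)
    (hx : ∀ᶠ z in 𝓝 x, wronskian f z ≠ 0) (h : ∀ᶠ z in 𝓝 x, monicOp f g z = 0) (a : Fin N) :
    deriv (cramerCoeff f g a) x = 0 := by
  suffices hzero : (fun a => deriv (cramerCoeff f g a) x) = 0 from congrFun hzero a
  have hx₀ := hx.self_of_nhds
  refine eq_zero_of_forall_sum_mul_iteratedDeriv hx₀ fun b => ?_
  have hderiv : HasDerivAt (fun z => ∑ a, cramerCoeff f g a z * iteratedDeriv (b : ℕ) (f a) z)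
      (∑ a, (deriv (cramerCoeff f g a) x * iteratedDeriv (b : ℕ) (f a) x +
        cramerCoeff f g a x * iteratedDeriv ((b : ℕ) + 1) (f a) x)) x :=
    HasDerivAt.fun_sum fun a _ => (differentiableAt_cramerCoeff hf hg hx₀ a).hasDerivAt.mul
      (hasDerivAt_iteratedDeriv (hf a) _ x)
  have hlocal : (fun z => ∑ a, cramerCoeff f g a z * iteratedDeriv (b : ℕ) (f a) z) =ᶠ[𝓝 x]
      iteratedDeriv (b : ℕ) g :=
    hx.mono fun z hz => sum_cramerCoeff_mul_iteratedDeriv hz g b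
  have heq := (hderiv.congr_of_eventuallyEq hlocal.symm).unique (hasDerivAt_iteratedDeriv hg b x)
  rwa [Finset.sum_add_distrib, sum_cramerCoeff_mul_iteratedDeriv_of_monicOp_eq_zero
    hx₀ h.self_of_nhds (Nat.succ_le_of_lt b.2), add_eq_right] at heq

theorem isOpen_wronskian_ne_zero (hf : ∀ a, f a ∈ entire) : IsOpen {x | wronskian f x ≠ 0} :=
  isOpen_ne_fun (mem_entire.1 (wronskian_mem_entire hf)).continuous continuous_const

theorem mem_span_of_monicOp_eq_zero (hf : ∀ a, f a ∈ entire) (hg : g ∈ entire)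
    (hx : wronskian f x ≠ 0) (h : ∀ z, monicOp f g z = 0) :
    g ∈ Submodule.span ℂ (Set.range f) := by
  obtain ⟨ε, hε, hball⟩ := Metric.isOpen_iff.1 (isOpen_wronskian_ne_zero hf) x hx
  have hconst : ∀ z ∈ Metric.ball x ε, ∀ a, cramerCoeff f g a z = cramerCoeff f g a x :=
    fun z hz a => Metric.isOpen_ball.is_const_of_deriv_eq_zero (convex_ball x ε).isPreconnected
      (fun w hw => (differentiableAt_cramerCoeff hf hg (hball hw) a).differentiableWithinAt)
      (fun w hw => deriv_cramerCoeff_eq_zero hf hg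
        ((isOpen_wronskian_ne_zero hf).mem_nhds (hball hw)) (.of_forall h) a)
      hz (Metric.mem_ball_self hε)
  refine (Submodule.mem_span_range_iff_exists_fun ℂ).2 ⟨fun a => cramerCoeff f g a x, ?_⟩
  refine sub_eq_zero.1 (eq_zero_of_mem_entire_of_eventually (z := x) (entire.sub_mem
    (entire.sum_mem fun a _ => entire.smul_mem _ (hf a)) hg) ?_)
  filter_upwards [mem_nhdsWithin_of_mem_nhds (Metric.ball_mem_nhds x hε)] with z hz
  have hval := sum_cramerCoeff_mul_iteratedDeriv_of_monicOp_eq_zero (hball hz) (h z) (Nat.zero_le _)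
  simp only [iteratedDeriv_zero, hconst z hz] at hval
  simp [hval]

end Wronskian

theorem exists_wronskian_ne_zero {N : ℕ} {f : Fin N → ℂ → ℂ} (hf : ∀ a, f a ∈ entire)
    (hind : LinearIndependent ℂ f) : ∃ x, wronskian f x ≠ 0 := by
  induction N with
  | zero => exact ⟨0, by simp [wronskian, genWronskian]⟩
  | succ N ih =>
    obtain ⟨hinit, hlast⟩ := linearIndependent_finSucc'.1 hind
    by_contra! hzero
    obtain ⟨x, hx⟩ := ih (f := Fin.init f) (fun a => hf _) hinit
    refine hlast (mem_span_of_monicOp_eq_zero (fun a => hf _) (hf _) hx fun z => ?_)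
    rw [monicOp_eq_wronskian_snoc_div, Fin.snoc_init_self, hzero, zero_div]

theorem eventually_wronskian_ne_zero {N : ℕ} {f : Fin N → ℂ → ℂ} (hf : ∀ a, f a ∈ entire)
    (hind : LinearIndependent ℂ f) (z : ℂ) : ∀ᶠ x in 𝓝[≠] z, wronskian f x ≠ 0 :=
  eventually_ne_zero_of_mem_entire (wronskian_mem_entire hf) (exists_wronskian_ne_zero hf hind) z

/-! ### Factorization of the monic operator -/

section Coefficients

variable {N : ℕ} {f : Fin N → ℂ → ℂ} {y : ℂ → ℂ} {x : ℂ}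

theorem analyticAt_of_mem_entire {w : ℂ → ℂ} (hw : w ∈ entire) (x : ℂ) : AnalyticAt ℂ w x :=
  (mem_entire.1 hw).analyticAt x

theorem analyticAt_wronskian (hf : ∀ a, f a ∈ entire) (x : ℂ) : AnalyticAt ℂ (wronskian f) x :=
  analyticAt_of_mem_entire (wronskian_mem_entire hf) x

theorem analyticAt_opCoeff (hf : ∀ a, f a ∈ entire) (hx : wronskian f x ≠ 0) (k : Fin (N + 1)) :
    AnalyticAt ℂ (opCoeff f k) x :=
  (analyticAt_const.mul (analyticAt_of_mem_entire (genWronskian_mem_entire hf _) x)).div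
    (analyticAt_wronskian hf x) hx

theorem analyticAt_monicOp (hf : ∀ a, f a ∈ entire) (hy : y ∈ entire) (hx : wronskian f x ≠ 0) :
    AnalyticAt ℂ (monicOp f y) x :=
  Finset.analyticAt_fun_sum _ fun k _ => (analyticAt_opCoeff hf hx k).mul
    (analyticAt_of_mem_entire (iteratedDeriv_mem_entire hy _) x)

theorem deriv_monicOp (hf : ∀ a, f a ∈ entire) (hy : y ∈ entire) (hx : wronskian f x ≠ 0) :
    deriv (monicOp f y) x = ∑ k : Fin (N + 1), (deriv (opCoeff f k) x *
      iteratedDeriv (k : ℕ) y x + opCoeff f k x * iteratedDeriv ((k : ℕ) + 1) y x) :=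
  (HasDerivAt.fun_sum fun k _ =>
    (analyticAt_opCoeff hf hx k).differentiableAt.hasDerivAt.mul
      (hasDerivAt_iteratedDeriv hy _ x)).deriv

/-- The coefficients of `(∂ - h'/h) ∘ D`, where `D` is the monic operator annihilating
`f₁, …, f_N`. -/
noncomputable def stepCoeff (f : Fin N → ℂ → ℂ) (h : ℂ → ℂ) (k : Fin (N + 2)) : ℂ → ℂ :=
  (Fin.cons (0 : ℂ → ℂ) (opCoeff f) : Fin (N + 2) → ℂ → ℂ) k +
    (Fin.snoc (fun j => deriv (opCoeff f j) - logDeriv h * opCoeff f j) (0 : ℂ → ℂ) :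
      Fin (N + 2) → ℂ → ℂ) k

theorem sum_stepCoeff_mul_iteratedDeriv (hf : ∀ a, f a ∈ entire) (hy : y ∈ entire)
    (hx : wronskian f x ≠ 0) (h : ℂ → ℂ) :
    ∑ k, stepCoeff f h k x * iteratedDeriv (k : ℕ) y x =
      deriv (monicOp f y) x - logDeriv h x * monicOp f y x := by
  rw [deriv_monicOp hf hy hx]
  simp only [stepCoeff, Pi.add_apply, add_mul, Finset.sum_add_distrib]
  rw [Fin.sum_univ_succ, Fin.sum_univ_castSucc (n := N + 1)]
  simp only [Fin.cons_zero, Fin.cons_succ, Fin.snoc_castSucc, Fin.snoc_last, Pi.zero_apply,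
    zero_mul, zero_add, add_zero, Fin.val_castSucc, Fin.val_succ, Pi.sub_apply, Pi.mul_apply,
    sub_mul, Finset.sum_sub_distrib, monicOp, Finset.mul_sum]
  simp only [mul_assoc]
  ring

end Coefficients

section Factorization

variable {N : ℕ} {f : Fin (N + 1) → ℂ → ℂ} {y : ℂ → ℂ} {x : ℂ}

theorem monicOp_init (f : Fin (N + 1) → ℂ → ℂ) :
    monicOp (Fin.init f) (f (Fin.last N)) =
      fun x => wronskian f x / wronskian (Fin.init f) x := by
  funext x
  rw [monicOp_eq_wronskian_snoc_div, Fin.snoc_init_self]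

theorem opCoeff_eq_stepCoeff (hf : ∀ a, f a ∈ entire) (hx : wronskian f x ≠ 0)
    (hinit : wronskian (Fin.init f) x ≠ 0) (k : Fin (N + 2)) :
    opCoeff f k x =
      stepCoeff (Fin.init f) (monicOp (Fin.init f) (f (Fin.last N))) k x := by
  refine opCoeff_eq_of_sum_mul_iteratedDeriv hx
    (c := fun k => stepCoeff (Fin.init f) (monicOp (Fin.init f) (f (Fin.last N))) k x) ?_ ?_ k
  · simp only [stepCoeff, Pi.add_apply, Fin.snoc_last, Pi.zero_apply, add_zero]
    rw [← Fin.succ_last, Fin.cons_succ, opCoeff_last hinit]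
  · intro a
    rw [sum_stepCoeff_mul_iteratedDeriv (f := Fin.init f) (fun a => hf _) (hf a) hinit]
    induction a using Fin.lastCases with
    | last =>
      have hne : monicOp (Fin.init f) (f (Fin.last N)) x ≠ 0 := by
        rw [monicOp_init]
        exact div_ne_zero hx hinit
      rw [logDeriv_apply, div_mul_cancel₀ _ hne, sub_self]
    | cast b =>
      have hzero : monicOp (Fin.init f) (f b.castSucc) = fun _ => 0 :=
        funext fun x => monicOp_self (Fin.init f) b x
      simp [hzero]

theorem monicOp_eq_deriv_sub (hf : ∀ a, f a ∈ entire) (hy : y ∈ entire) (hx : wronskian f x ≠ 0)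
    (hinit : wronskian (Fin.init f) x ≠ 0) :
    monicOp f y x = deriv (monicOp (Fin.init f) y) x -
      logDeriv (monicOp (Fin.init f) (f (Fin.last N))) x * monicOp (Fin.init f) y x := by
  rw [← sum_stepCoeff_mul_iteratedDeriv (f := Fin.init f) (fun a => hf _) hy hinit, monicOp]
  exact Finset.sum_congr rfl fun k _ => by rw [opCoeff_eq_stepCoeff hf hx hinit]

theorem deriv_wronskian_snoc_div (hf : ∀ a, f a ∈ entire) (hy : y ∈ entire)
    (hx : wronskian f x ≠ 0) (hinit : wronskian (Fin.init f) x ≠ 0) :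
    deriv (fun x => wronskian (Fin.snoc (Fin.init f) y : Fin (N + 1) → ℂ → ℂ) x /
      wronskian f x) x = wronskian (Fin.init f) x / wronskian f x * monicOp f y x := by
  have hf' : ∀ a, Fin.init f a ∈ entire := fun a => hf _
  have hlast : monicOp (Fin.init f) (f (Fin.last N)) x ≠ 0 := by
    rw [monicOp_init]
    exact div_ne_zero hx hinit
  have hinv : wronskian (Fin.init f) x / wronskian f x =
      (monicOp (Fin.init f) (f (Fin.last N)) x)⁻¹ := by
    rw [monicOp_init, inv_div]
  have hquot : (fun x => wronskian (Fin.snoc (Fin.init f) y : Fin (N + 1) → ℂ → ℂ) x /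
      wronskian f x) =ᶠ[𝓝 x]
        fun z => monicOp (Fin.init f) y z / monicOp (Fin.init f) (f (Fin.last N)) z := by
    filter_upwards [(isOpen_wronskian_ne_zero hf').mem_nhds hinit] with z hz
    rw [monicOp_init, monicOp_eq_wronskian_snoc_div, div_div_div_cancel_right₀ hz]
  rw [hquot.deriv_eq, deriv_fun_div (analyticAt_monicOp hf' hy hinit).differentiableAt
    (analyticAt_monicOp hf' (hf _) hinit).differentiableAt hlast,
    monicOp_eq_deriv_sub hf hy hx hinit, logDeriv_apply, hinv]
  field_simp

theorem hasDerivAt_of_eventuallyEq_nhdsNE {K R : ℂ → ℂ} {x : ℂ} (hK : AnalyticAt ℂ K x)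
    (hR : ContinuousAt R x) (h : deriv K =ᶠ[𝓝[≠] x] R) : HasDerivAt K (R x) x := by
  have hderiv := (hK.deriv.continuousAt.eventuallyEq_nhds_iff_eventuallyEq_nhdsNE hR).1 h
  exact hderiv.eq_of_nhds ▸ hK.differentiableAt.hasDerivAt

theorem hasDerivAt_wronskian_snoc_div (hf : ∀ a, f a ∈ entire)
    (hind : LinearIndependent ℂ (Fin.init f)) (hy : y ∈ entire) (hx : wronskian f x ≠ 0) :
    HasDerivAt (fun x => wronskian (Fin.snoc (Fin.init f) y : Fin (N + 1) → ℂ → ℂ) x /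
      wronskian f x) (wronskian (Fin.init f) x / wronskian f x * monicOp f y x) x := by
  have hf' : ∀ a, Fin.init f a ∈ entire := fun a => hf _
  have hsnoc : ∀ a, (Fin.snoc (Fin.init f) y : Fin (N + 1) → ℂ → ℂ) a ∈ entire := by
    refine Fin.lastCases ?_ fun b => ?_
    · simpa using hy
    · simpa using hf' b
  refine hasDerivAt_of_eventuallyEq_nhdsNE
    ((analyticAt_wronskian hsnoc x).fun_div (analyticAt_wronskian hf x) hx)
    (((analyticAt_wronskian hf' x).div (analyticAt_wronskian hf x) hx).mul
      (analyticAt_monicOp hf hy hx)).continuousAt ?_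
  filter_upwards [mem_nhdsWithin_of_mem_nhds ((isOpen_wronskian_ne_zero hf).mem_nhds hx),
    eventually_wronskian_ne_zero hf' hind x] with z hz hz'
  exact deriv_wronskian_snoc_div hf hy hz hz'

end Factorization

/-! ### Pole orders -/

/-- The function `f` is meromorphic at `z`, with a zero of order at least `s` there. The
meromorphy is part of the definition because `meromorphicOrderAt` is `0` without it. -/
structure OrderAtLeast (s : ℤ) (f : ℂ → ℂ) (z : ℂ) : Prop where
  meromorphicAt : MeromorphicAt f z
  le_order : (s : WithTop ℤ) ≤ meromorphicOrderAt f z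

namespace OrderAtLeast

variable {s t : ℤ} {f g : ℂ → ℂ} {z : ℂ}

theorem of_analyticAt (hf : AnalyticAt ℂ f z) : OrderAtLeast 0 f z :=
  ⟨hf.meromorphicAt, hf.meromorphicOrderAt_nonneg⟩

theorem of_mem_entire (hf : f ∈ entire) (z : ℂ) : OrderAtLeast 0 f z :=
  of_analyticAt (analyticAt_of_mem_entire hf z)

theorem sub_pow (z : ℂ) (n : ℕ) : OrderAtLeast n (fun x => (x - z) ^ n) z :=
  ⟨by fun_prop, (meromorphicOrderAt_pow_id_sub_const (x := z) (n := n)).ge⟩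

theorem zero (s : ℤ) (z : ℂ) : OrderAtLeast s 0 z :=
  ⟨.const 0 z, le_top.trans_eq
    ((meromorphicOrderAt_eq_top_iff (f := 0)).2 <| .of_forall fun _ => rfl).symm⟩

theorem mono (hf : OrderAtLeast s f z) (hts : t ≤ s) : OrderAtLeast t f z :=
  ⟨hf.meromorphicAt, (WithTop.coe_le_coe.2 hts).trans hf.le_order⟩

theorem congr (hf : OrderAtLeast s f z) (hfg : f =ᶠ[𝓝[≠] z] g) : OrderAtLeast s g z :=
  ⟨hf.meromorphicAt.congr hfg, meromorphicOrderAt_congr hfg ▸ hf.le_order⟩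

theorem add (hf : OrderAtLeast s f z) (hg : OrderAtLeast s g z) : OrderAtLeast s (f + g) z :=
  ⟨hf.meromorphicAt.add hg.meromorphicAt, (le_min hf.le_order hg.le_order).trans
    (meromorphicOrderAt_add hf.meromorphicAt hg.meromorphicAt)⟩

theorem neg (hf : OrderAtLeast s f z) : OrderAtLeast s (-f) z :=
  ⟨hf.meromorphicAt.neg, meromorphicOrderAt_neg (f := f) ▸ hf.le_order⟩

theorem sub (hf : OrderAtLeast s f z) (hg : OrderAtLeast s g z) : OrderAtLeast s (f - g) z :=
  sub_eq_add_neg f g ▸ hf.add hg.neg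

theorem mul (hf : OrderAtLeast s f z) (hg : OrderAtLeast t g z) :
    OrderAtLeast (s + t) (f * g) z := by
  refine ⟨hf.meromorphicAt.mul hg.meromorphicAt, ?_⟩
  rw [meromorphicOrderAt_mul hf.meromorphicAt hg.meromorphicAt, WithTop.coe_add]
  exact add_le_add hf.le_order hg.le_order

theorem sum {ι : Type*} {u : Finset ι} {F : ι → ℂ → ℂ} (hF : ∀ i ∈ u, OrderAtLeast s (F i) z) :
    OrderAtLeast s (∑ i ∈ u, F i) z :=
  Finset.sum_induction F (OrderAtLeast s · z) (fun _ _ => add) (zero s z) hF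

theorem deriv (hf : OrderAtLeast s f z) (hs : s ≤ 0) : OrderAtLeast (s - 1) (deriv f) z := by
  refine ⟨hf.meromorphicAt.deriv, ?_⟩
  by_cases hnonneg : 0 ≤ meromorphicOrderAt f z
  · obtain ⟨g, hg, hfg⟩ := hf.meromorphicAt.meromorphicOrderAt_nonneg_iff.1 hnonneg
    rw [meromorphicOrderAt_congr hfg.nhdsNE_deriv]
    exact le_trans (by exact_mod_cast (by lia : s - 1 ≤ 0)) hg.deriv.meromorphicOrderAt_nonneg
  · have htop : meromorphicOrderAt f z ≠ ⊤ := fun htop => hnonneg (htop ▸ le_top)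
    have hle := hf.le_order
    lift meromorphicOrderAt f z to ℤ using htop with n hn
    have hn0 : n ≠ 0 := fun h => hnonneg (by simp [h])
    rw [meromorphicOrderAt_deriv_eq_sub_one (by exact_mod_cast hn0) hn.symm]
    exact WithTop.coe_le_coe.2 (sub_le_sub_right (WithTop.coe_le_coe.1 hle) 1)

theorem logDeriv (hf : MeromorphicAt f z) (hne : ∀ᶠ x in 𝓝[≠] z, f x ≠ 0) :
    OrderAtLeast (-1) (logDeriv f) z := by
  refine ⟨hf.logDeriv, ?_⟩
  by_cases hzero : meromorphicOrderAt f z = 0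
  · exact le_trans (by exact_mod_cast (by lia : (-1 : ℤ) ≤ 0))
      (meromorphicOrderAt_logDeriv_nonneg hf hzero)
  · exact (meromorphicOrderAt_logDeriv_eq_neg_one hf hzero
      ((meromorphicOrderAt_ne_top_iff_eventually_ne_zero hf).2 hne)).ge

end OrderAtLeast

section PoleOrders

variable {M N : ℕ} {f : Fin N → ℂ → ℂ} {g : Fin M → ℂ → ℂ}

theorem meromorphicAt_opCoeff (hf : ∀ a, f a ∈ entire) (k : Fin (N + 1)) (z : ℂ) :
    MeromorphicAt (opCoeff f k) z :=
  ((MeromorphicAt.const _ z).mul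
    (analyticAt_of_mem_entire (genWronskian_mem_entire hf _) z).meromorphicAt).div
      (analyticAt_wronskian hf z).meromorphicAt

theorem meromorphicAt_wronskian_div (hf : ∀ a, f a ∈ entire) (hg : ∀ a, g a ∈ entire) (z : ℂ) :
    MeromorphicAt (fun x => wronskian f x / wronskian g x) z :=
  (analyticAt_wronskian hf z).meromorphicAt.div (analyticAt_wronskian hg z).meromorphicAt

theorem eventually_wronskian_div_ne_zero (hf : ∀ a, f a ∈ entire) (hg : ∀ a, g a ∈ entire)
    (hf_ind : LinearIndependent ℂ f) (hg_ind : LinearIndependent ℂ g) (z : ℂ) :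
    ∀ᶠ x in 𝓝[≠] z, wronskian f x / wronskian g x ≠ 0 := by
  filter_upwards [eventually_wronskian_ne_zero hf hf_ind z,
    eventually_wronskian_ne_zero hg hg_ind z] with x using div_ne_zero

theorem orderAtLeast_stepCoeff {h : ℂ → ℂ} {z : ℂ}
    (hf : ∀ k : Fin (N + 1), OrderAtLeast ((k : ℕ) - N) (opCoeff f k) z)
    (hh : OrderAtLeast (-1) (logDeriv h) z) (k : Fin (N + 2)) :
    OrderAtLeast ((k : ℕ) - (N + 1)) (stepCoeff f h k) z := by
  refine OrderAtLeast.add ?_ ?_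
  · induction k using Fin.cases with
    | zero => exact .zero _ z
    | succ j =>
      rw [Fin.cons_succ, Fin.val_succ]
      exact (hf j).mono (by lia)
  · induction k using Fin.lastCases with
    | last =>
      rw [Fin.snoc_last]
      exact .zero _ z
    | cast j =>
      have hj := j.is_le
      rw [Fin.snoc_castSucc, Fin.val_castSucc]
      exact (((hf j).deriv (by lia)).mono (by lia)).sub ((hh.mul (hf j)).mono (by lia))

/-- The monic operator annihilating independent entire functions is Fuchsian. -/
theorem orderAtLeast_opCoeff (hf : ∀ a, f a ∈ entire) (hind : LinearIndependent ℂ f) (z : ℂ)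
    (k : Fin (N + 1)) : OrderAtLeast ((k : ℕ) - N) (opCoeff f k) z := by
  induction N with
  | zero =>
    obtain rfl : k = Fin.last 0 := Subsingleton.elim (α := Fin 1) k _
    have hone : opCoeff f (Fin.last 0) = fun _ => 1 := by
      funext x
      rw [opCoeff_last]
      simp [wronskian, genWronskian]
    rw [hone]
    exact .of_mem_entire (mem_entire.2 (differentiable_const 1)) z
  | succ N ih =>
    have hf' : ∀ a, Fin.init f a ∈ entire := fun a => hf _
    have hind' : LinearIndependent ℂ (Fin.init f) :=
      hind.comp _ (Fin.castSucc_injective N)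
    have hlog : OrderAtLeast (-1) (logDeriv (monicOp (Fin.init f) (f (Fin.last N)))) z := by
      rw [monicOp_init]
      exact .logDeriv (meromorphicAt_wronskian_div hf hf' z)
        (eventually_wronskian_div_ne_zero hf hf' hind hind' z)
    refine OrderAtLeast.congr (mod_cast orderAtLeast_stepCoeff (ih hf' hind') hlog k) ?_
    filter_upwards [eventually_wronskian_ne_zero hf hind z,
      eventually_wronskian_ne_zero hf' hind' z] with x hx hx'
    exact (opCoeff_eq_stepCoeff hf hx hx' k).symm

theorem orderAtLeast_monicOp (hf : ∀ a, f a ∈ entire) (hind : LinearIndependent ℂ f)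
    {y : ℂ → ℂ} (hy : y ∈ entire) (z : ℂ) : OrderAtLeast (-N) (monicOp f y) z := by
  have hsum : monicOp f y = ∑ k : Fin (N + 1), opCoeff f k * iteratedDeriv (k : ℕ) y := by
    funext x
    simp [monicOp]
  rw [hsum]
  exact .sum fun k _ => ((orderAtLeast_opCoeff hf hind z k).mul
    (.of_mem_entire (iteratedDeriv_mem_entire hy k) z)).mono (by lia)

theorem meromorphicOrderAt_wronskian_init_div_le {f : Fin (N + 1) → ℂ → ℂ}
    (hf : ∀ a, f a ∈ entire) (hind : LinearIndependent ℂ f) (z : ℂ) :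
    meromorphicOrderAt (fun x => wronskian (Fin.init f) x / wronskian f x) z ≤ (N : ℤ) := by
  have hf' : ∀ a, Fin.init f a ∈ entire := fun a => hf _
  have hind' : LinearIndependent ℂ (Fin.init f) :=
    hind.comp _ (Fin.castSucc_injective N)
  have hinv : (fun x => wronskian (Fin.init f) x / wronskian f x) =
      (monicOp (Fin.init f) (f (Fin.last N)))⁻¹ := by
    rw [monicOp_init]
    exact funext fun x => (inv_div _ _).symm
  have horder := orderAtLeast_monicOp hf' hind' (hf (Fin.last N)) z
  have htop : meromorphicOrderAt (monicOp (Fin.init f) (f (Fin.last N))) z ≠ ⊤ := by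
    rw [meromorphicOrderAt_ne_top_iff_eventually_ne_zero horder.meromorphicAt, monicOp_init]
    exact eventually_wronskian_div_ne_zero hf hf' hind hind' z
  have hle := horder.le_order
  rw [hinv, meromorphicOrderAt_inv]
  lift meromorphicOrderAt (monicOp (Fin.init f) (f (Fin.last N))) z to ℤ using htop with n hn
  exact WithTop.coe_le_coe.2 (neg_le.1 (WithTop.coe_le_coe.1 hle))

end PoleOrders

/-! ### The conjugate space -/

section DualFun

variable {m N : ℕ}

/-- The matrix `S` with the extra last row `v`. -/
def snocRow {ι : Type*} (S : Matrix (Fin m) ι ℂ) (v : ι → ℂ) : Matrix (Fin (m + 1)) ι ℂ :=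
  Matrix.of (Fin.snoc (α := fun _ => ι → ℂ) (Matrix.of.symm S) v)

theorem snocRow_castSucc {ι : Type*} (S : Matrix (Fin m) ι ℂ) (v : ι → ℂ) (i : Fin m) :
    snocRow S v i.castSucc = S i :=
  Fin.snoc_castSucc (α := fun _ => ι → ℂ) ..

theorem snocRow_last {ι : Type*} (S : Matrix (Fin m) ι ℂ) (v : ι → ℂ) :
    snocRow S v (Fin.last m) = v :=
  Fin.snoc_last (α := fun _ => ι → ℂ) ..

theorem det_snocRow (S : Matrix (Fin m) (Fin (m + 1)) ℂ) (v : Fin (m + 1) → ℂ) :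
    (snocRow S v).det =
      ∑ a : Fin (m + 1), (-1) ^ (m + (a : ℕ)) * (S.submatrix id a.succAbove).det * v a := by
  rw [Matrix.det_succ_row _ (Fin.last m)]
  refine Finset.sum_congr rfl fun a _ => ?_
  have hminor : (snocRow S v).submatrix (Fin.last m).succAbove a.succAbove =
      S.submatrix id a.succAbove := by
    ext i j
    simp [snocRow_castSucc]
  rw [hminor, snocRow_last, Fin.val_last, mul_right_comm]

theorem det_snocRow_single_last (S : Matrix (Fin m) (Fin (m + 1)) ℂ) :
    (snocRow S (Pi.single (Fin.last m) 1)).det = (S.submatrix id Fin.castSucc).det := by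
  rw [det_snocRow, Finset.sum_eq_single (Fin.last m) (fun a _ ha => by simp [ha]) (by simp)]
  simp [← two_mul, pow_mul]

theorem snocRow_mul {ι κ : Type*} [Fintype ι] (S : Matrix (Fin m) ι ℂ) (v : ι → ℂ)
    (M : Matrix ι κ ℂ) : snocRow S v * M = snocRow (S * M) (Matrix.vecMul v M) := by
  ext i b
  induction i using Fin.lastCases with
  | last => rw [snocRow_last, Matrix.mul_apply, snocRow_last, Matrix.vecMul, dotProduct]
  | cast i => rw [snocRow_castSucc, Matrix.mul_apply, snocRow_castSucc, Matrix.mul_apply]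

/-- The Wronskian matrix of a family of functions, with one row for each function. -/
noncomputable def wronskianMatrix (f : Fin N → ℂ → ℂ) (x : ℂ) : Matrix (Fin N) (Fin N) ℂ :=
  Matrix.of fun a b : Fin N => iteratedDeriv (b : ℕ) (f a) x

/-- The last row of the inverse of the Wronskian matrix. These functions span the conjugate
space, see `IsEntireBasis.conjugateSpace_eq`. -/
noncomputable def dualFun (f : Fin (m + 1) → ℂ → ℂ) (a : Fin (m + 1)) (x : ℂ) : ℂ :=
  (wronskianMatrix f x)⁻¹ (Fin.last m) a

theorem dualFun_eq (f : Fin (m + 1) → ℂ → ℂ) (a : Fin (m + 1)) (x : ℂ) :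
    dualFun f a x = (-1) ^ ((a : ℕ) + m) * (wronskian (fun i => f (a.succAbove i)) x /
      wronskian f x) := by
  rw [dualFun, Matrix.inv_def, Matrix.smul_apply, Matrix.adjugate_fin_succ_eq_det_submatrix,
    Ring.inverse_eq_inv', smul_eq_mul]
  have hminor : (wronskianMatrix f x).submatrix a.succAbove (Fin.last m).succAbove =
      Matrix.of fun i b : Fin m => iteratedDeriv (b : ℕ) (f (a.succAbove i)) x := by
    ext i b
    simp [wronskianMatrix]
  rw [hminor]
  simp only [wronskian, genWronskian, wronskianMatrix, Fin.val_last]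
  ring

theorem dualFun_last (f : Fin (m + 1) → ℂ → ℂ) :
    dualFun f (Fin.last m) = fun x => wronskian (Fin.init f) x / wronskian f x := by
  funext x
  rw [dualFun_eq, Fin.val_last, (Even.add_self m).neg_one_pow, one_mul]
  simp only [Fin.succAbove_last, Fin.init_def]

theorem wronskianMatrix_sum_smul {f : Fin N → ℂ → ℂ} (hf : ∀ a, f a ∈ entire)
    (T : Matrix (Fin N) (Fin N) ℂ) (x : ℂ) :
    wronskianMatrix (fun i => ∑ a, T i a • f a) x = T * wronskianMatrix f x := by
  ext i b
  simp [wronskianMatrix, Matrix.mul_apply, iteratedDeriv_sum_smul _ hf]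

theorem wronskian_sum_smul_eq_det_submatrix {f : Fin (m + 1) → ℂ → ℂ} (hf : ∀ a, f a ∈ entire)
    (S : Matrix (Fin m) (Fin (m + 1)) ℂ) (x : ℂ) :
    wronskian (fun i => ∑ a, S i a • f a) x =
      ((S * wronskianMatrix f x).submatrix id Fin.castSucc).det := by
  rw [wronskian, genWronskian]
  congr 1
  ext i b
  simp [wronskianMatrix, Matrix.mul_apply, iteratedDeriv_sum_smul _ hf]

theorem wronskian_div_eq_sum_dualFun {f : Fin (m + 1) → ℂ → ℂ} (hf : ∀ a, f a ∈ entire)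
    (S : Matrix (Fin m) (Fin (m + 1)) ℂ) (x : ℂ) :
    wronskian (fun i => ∑ a, S i a • f a) x / wronskian f x =
      ∑ a : Fin (m + 1), (-1) ^ (m + (a : ℕ)) * (S.submatrix id a.succAbove).det *
        dualFun f a x := by
  by_cases hx : wronskian f x = 0
  · simp [hx, dualFun_eq]
  have hdet : IsUnit (wronskianMatrix f x).det := isUnit_iff_ne_zero.2 hx
  have hrow : Matrix.vecMul (fun a => dualFun f a x) (wronskianMatrix f x) =
      Pi.single (Fin.last m) 1 := by
    ext b
    simpa [Matrix.mul_apply, Matrix.one_apply, Matrix.vecMul, dotProduct, dualFun,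
      Pi.single_apply, eq_comm] using congrFun (congrFun (Matrix.nonsing_inv_mul _ hdet)
        (Fin.last m)) b
  rw [div_eq_iff hx, ← det_snocRow S, show wronskian f x = (wronskianMatrix f x).det from rfl,
    ← Matrix.det_mul, snocRow_mul, hrow, det_snocRow_single_last,
    wronskian_sum_smul_eq_det_submatrix hf]

theorem exists_matrix_mulVec_eq {ι : Type*} [Fintype ι] [DecidableEq ι] {c d : ι → ℂ}
    (hc : c ≠ 0) (hd : d ≠ 0) : ∃ T : Matrix ι ι ℂ, T.det ≠ 0 ∧ T.mulVec c = d := by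
  obtain ⟨A, hA⟩ := SeparatingDual.exists_continuousLinearEquiv_apply_eq (R := ℂ) hc hd
  refine ⟨LinearMap.toMatrix' (A.toLinearEquiv : (ι → ℂ) →ₗ[ℂ] ι → ℂ), ?_, ?_⟩
  · rw [LinearMap.det_toMatrix']
    exact (LinearEquiv.isUnit_det' A.toLinearEquiv).ne_zero
  · rw [LinearMap.toMatrix'_mulVec]
    exact hA

theorem exists_sum_smul_dualFun_eq {f : Fin (m + 1) → ℂ → ℂ} (hf : ∀ a, f a ∈ entire)
    {c : Fin (m + 1) → ℂ} (hc : c ≠ 0) :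
    ∃ T : Matrix (Fin (m + 1)) (Fin (m + 1)) ℂ, T.det ≠ 0 ∧
      ∑ a, c a • dualFun f a = dualFun (fun i => ∑ a, T i a • f a) (Fin.last m) := by
  obtain ⟨T, hT, hTc⟩ := exists_matrix_mulVec_eq hc (d := Pi.single (Fin.last m) 1) (by simp)
  refine ⟨T, hT, funext fun x => ?_⟩
  have hcol : (T⁻¹).mulVec (Pi.single (Fin.last m) 1) = c := by
    rw [← hTc, Matrix.mulVec_mulVec, Matrix.nonsing_inv_mul _ (isUnit_iff_ne_zero.2 hT),
      Matrix.one_mulVec]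
  rw [Matrix.mulVec_single_one] at hcol
  rw [dualFun, wronskianMatrix_sum_smul hf, Matrix.mul_inv_rev, Matrix.mul_apply]
  simp only [Finset.sum_apply, Pi.smul_apply, smul_eq_mul, dualFun]
  exact Finset.sum_congr rfl fun a _ => by rw [← congrFun hcol a, Matrix.col_apply, mul_comm]

end DualFun

namespace IsEntireBasis

variable {m N : ℕ} {V : Submodule ℂ (ℂ → ℂ)}

theorem opCoeff_eq {f g : Fin N → ℂ → ℂ} (h : IsEntireBasis V f) (hg : IsEntireBasis V g) :
    opCoeff g = opCoeff f := by
  obtain ⟨T, hT, rfl⟩ := h.exists_matrix hg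
  exact opCoeff_sum_smul h.mem_entire hT

theorem monicOperator_eq {f : Fin N → ℂ → ℂ} (h : IsEntireBasis V f) :
    monicOperator V = monicOp f := by
  have := h.finiteDimensional
  obtain rfl := h.finrank_eq
  funext y x
  rw [monicOperator, monicOp, ← h.opCoeff_eq (isEntireBasis_basisOf h.le_entire)]
  rfl

theorem exists_wronskianOf_eq {f : Fin N → ℂ → ℂ} (h : IsEntireBasis V f) :
    ∃ d : ℂ, d ≠ 0 ∧ ∀ x, wronskianOf V x = d * wronskian f x := by
  have := h.finiteDimensional
  obtain rfl := h.finrank_eq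
  obtain ⟨T, hT, hbasis⟩ := h.exists_matrix (isEntireBasis_basisOf h.le_entire)
  exact ⟨T.det, hT, fun x => by rw [wronskianOf, hbasis, wronskian_sum_smul h.mem_entire]⟩

variable {f : Fin (m + 1) → ℂ → ℂ}

theorem conjugateSpace_eq (h : IsEntireBasis V f) :
    conjugateSpace V = Submodule.span ℂ (Set.range (dualFun f)) := by
  obtain ⟨d, hd, hwr⟩ := h.exists_wronskianOf_eq
  obtain rfl : m = Module.finrank ℂ V - 1 := by have := h.finrank_eq; lia
  refine le_antisymm (Submodule.span_le.2 ?_) (Submodule.span_le.2 ?_)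
  · rintro _ ⟨φ, hφ, rfl⟩
    choose S hS using fun i => h.mem_iff.1 (hφ i)
    obtain rfl : (fun i => ∑ a, S i a • f a) = φ := funext hS
    refine (Submodule.mem_span_range_iff_exists_fun ℂ).2 ⟨fun a => d⁻¹ *
      ((-1) ^ (Module.finrank ℂ V - 1 + (a : ℕ)) *
        ((Matrix.of S).submatrix id a.succAbove).det), funext fun x => ?_⟩
    rw [hwr, div_mul_eq_div_div_swap,
      show (fun i => ∑ a, S i a • f a) = fun i => ∑ a, Matrix.of S i a • f a from rfl,
      wronskian_div_eq_sum_dualFun h.mem_entire, div_eq_inv_mul, Finset.mul_sum]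
    simp only [Finset.sum_apply, Pi.smul_apply, smul_eq_mul, mul_assoc]
  · rintro _ ⟨a, rfl⟩
    have hdual : dualFun f a = ((-1) ^ ((a : ℕ) + (Module.finrank ℂ V - 1)) * d) •
        fun x => wronskian (fun i => f (a.succAbove i)) x / wronskianOf V x := by
      funext x
      rw [dualFun_eq, Pi.smul_apply, smul_eq_mul, hwr]
      field_simp
    rw [hdual]
    exact Submodule.smul_mem _ _ (Submodule.subset_span ⟨_, fun i => h.mem _, rfl⟩)

theorem exists_sum_smul_dualFun_eq (h : IsEntireBasis V f) {c : Fin (m + 1) → ℂ} (hc : c ≠ 0) :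
    ∃ g : Fin (m + 1) → ℂ → ℂ, IsEntireBasis V g ∧
      ∑ a, c a • dualFun f a = dualFun g (Fin.last m) := by
  obtain ⟨T, hT, hc⟩ := Bispectral.exists_sum_smul_dualFun_eq h.mem_entire hc
  exact ⟨_, h.sum_smul hT, hc⟩

theorem exists_eq_dualFun_of_mem (h : IsEntireBasis V f) {g : ℂ → ℂ} (hg : g ∈ conjugateSpace V)
    (hg0 : g ≠ 0) : ∃ f' : Fin (m + 1) → ℂ → ℂ, IsEntireBasis V f' ∧
      g = dualFun f' (Fin.last m) := by
  rw [h.conjugateSpace_eq, Submodule.mem_span_range_iff_exists_fun] at hg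
  obtain ⟨c, rfl⟩ := hg
  exact h.exists_sum_smul_dualFun_eq fun hc => hg0 (by simp [hc])

theorem dualFun_last_ne_zero (h : IsEntireBasis V f) : dualFun f (Fin.last m) ≠ 0 := fun hzero => by
  obtain ⟨x, hx⟩ := (eventually_wronskian_div_ne_zero (f := Fin.init f)
    (fun i => h.mem_entire i.castSucc) h.mem_entire h.linearIndependent_init
    h.linearIndependent 0).exists
  exact hx (congrFun (dualFun_last f ▸ hzero) x)

theorem finrank_conjugateSpace (h : IsEntireBasis V f) :
    Module.finrank ℂ (conjugateSpace V) = m + 1 := by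
  have hind : LinearIndependent ℂ (dualFun f) := by
    refine Fintype.linearIndependent_iff.2 fun c hc => ?_
    by_contra! hne
    obtain ⟨i, hi⟩ := hne
    obtain ⟨g, hg, heq⟩ := h.exists_sum_smul_dualFun_eq (c := c) fun h0 => hi (congrFun h0 i)
    exact hg.dualFun_last_ne_zero (heq ▸ hc)
  rw [h.conjugateSpace_eq, finrank_span_eq_card hind, Fintype.card_fin]

end IsEntireBasis

/-! ### Rational functions regular at infinity -/

/-- Outside a finite set, `b` is a rational function with the value `q` at infinity. -/
def IsRationalWithLimit (b : ℂ → ℂ) (q : ℂ) : Prop :=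
  ∃ n d : ℂ[X], d ≠ 0 ∧ n.natDegree ≤ d.natDegree ∧ n.coeff d.natDegree = q * d.leadingCoeff ∧
    ∀ᶠ x in cofinite, b x = n.eval x / d.eval x

theorem eventually_eval_ne_zero {d : ℂ[X]} (hd : d ≠ 0) : ∀ᶠ x in cofinite, d.eval x ≠ 0 := by
  rw [Filter.eventually_cofinite]
  simpa using d.finite_setOfPred_isRoot hd

theorem eventually_cofinite_nhds {α : Type*} [TopologicalSpace α] [T1Space α] {P : α → Prop}
    (h : ∀ᶠ x in cofinite, P x) : ∀ᶠ x in cofinite, ∀ᶠ y in 𝓝 x, P y := by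
  have hfin : {x | ¬ P x}.Finite := Filter.eventually_cofinite.1 h
  filter_upwards [h] with x hx
  filter_upwards [hfin.isClosed.isOpen_compl.mem_nhds (not_not.2 hx)] with y hy
  exact not_not.1 hy

namespace IsRationalWithLimit

variable {a b : ℂ → ℂ} {p q : ℂ}

theorem congr (hb : IsRationalWithLimit b q) (hab : ∀ᶠ x in cofinite, a x = b x) :
    IsRationalWithLimit a q := by
  obtain ⟨n, d, hd, hdeg, hcoeff, heval⟩ := hb
  refine ⟨n, d, hd, hdeg, hcoeff, ?_⟩
  filter_upwards [hab, heval] with x using Eq.trans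

theorem const (c : ℂ) : IsRationalWithLimit (fun _ => c) c :=
  ⟨C c, 1, one_ne_zero, by simp, by simp, by simp⟩

theorem add (ha : IsRationalWithLimit a p) (hb : IsRationalWithLimit b q) :
    IsRationalWithLimit (a + b) (p + q) := by
  obtain ⟨n, d, hd, hdeg, hcoeff, heval⟩ := ha
  obtain ⟨n', d', hd', hdeg', hcoeff', heval'⟩ := hb
  refine ⟨n * d' + d * n', d * d', mul_ne_zero hd hd', ?_, ?_, ?_⟩
  · rw [natDegree_mul hd hd']
    exact natDegree_add_le_of_degree_le (natDegree_mul_le_of_le hdeg le_rfl)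
      (natDegree_mul_le_of_le le_rfl hdeg')
  · rw [natDegree_mul hd hd', coeff_add, coeff_mul_add_eq_of_natDegree_le hdeg le_rfl,
      coeff_mul_add_eq_of_natDegree_le le_rfl hdeg', hcoeff, hcoeff', leadingCoeff_mul,
      coeff_natDegree, coeff_natDegree]
    ring
  · filter_upwards [heval, heval', eventually_eval_ne_zero hd, eventually_eval_ne_zero hd']
      with x hax hbx hx hx'
    rw [Pi.add_apply, hax, hbx]
    simp only [eval_add, eval_mul]
    field_simp

theorem mul (ha : IsRationalWithLimit a p) (hb : IsRationalWithLimit b q) :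
    IsRationalWithLimit (a * b) (p * q) := by
  obtain ⟨n, d, hd, hdeg, hcoeff, heval⟩ := ha
  obtain ⟨n', d', hd', hdeg', hcoeff', heval'⟩ := hb
  refine ⟨n * n', d * d', mul_ne_zero hd hd', ?_, ?_, ?_⟩
  · rw [natDegree_mul hd hd']
    exact natDegree_mul_le_of_le hdeg hdeg'
  · rw [natDegree_mul hd hd', coeff_mul_add_eq_of_natDegree_le hdeg hdeg', hcoeff, hcoeff',
      leadingCoeff_mul]
    ring
  · filter_upwards [heval, heval'] with x hax hbx
    rw [Pi.mul_apply, hax, hbx, eval_mul, eval_mul, div_mul_div_comm]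

theorem sub (ha : IsRationalWithLimit a p) (hb : IsRationalWithLimit b q) :
    IsRationalWithLimit (a - b) (p - q) := by
  have hab : a - b = a + (fun _ => -1) * b := by
    funext x
    simp [sub_eq_add_neg]
  rw [hab, sub_eq_add_neg p, ← neg_one_mul q]
  exact ha.add ((const (-1)).mul hb)

theorem deriv (hb : IsRationalWithLimit b q) : IsRationalWithLimit (deriv b) 0 := by
  obtain ⟨n, d, hd, hdeg, -, heval⟩ := hb
  have hderiv : ∀ {u v : ℂ[X]}, u.natDegree ≤ d.natDegree → v.natDegree ≤ d.natDegree →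
      (derivative u * v).natDegree ≤ d.natDegree + d.natDegree ∧
      (derivative u * v).coeff (d.natDegree + d.natDegree) = 0 := by
    intro u v hu hv
    have hu' : (derivative u).natDegree ≤ d.natDegree :=
      (natDegree_derivative_le u).trans (by lia)
    refine ⟨natDegree_mul_le_of_le hu' hv, ?_⟩
    rw [coeff_mul_add_eq_of_natDegree_le hu' hv, coeff_derivative,
      coeff_eq_zero_of_natDegree_lt (Nat.lt_succ_of_le hu), zero_mul, zero_mul]
  refine ⟨derivative n * d - derivative d * n, d * d, mul_ne_zero hd hd, ?_, ?_, ?_⟩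
  · rw [natDegree_mul hd hd]
    exact (natDegree_sub_le_of_le (hderiv hdeg le_rfl).1 (hderiv le_rfl hdeg).1).trans
      (max_self _).le
  · rw [natDegree_mul hd hd, coeff_sub, (hderiv hdeg le_rfl).2, (hderiv le_rfl hdeg).2, sub_zero,
      zero_mul]
  · filter_upwards [eventually_cofinite_nhds heval, eventually_eval_ne_zero hd] with x hbx hx
    rw [EventuallyEq.deriv_eq (f := fun x => n.eval x / d.eval x) hbx,
      deriv_fun_div n.differentiableAt d.differentiableAt hx, Polynomial.deriv, Polynomial.deriv]
    simp only [eval_sub, eval_mul]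
    rw [pow_two, mul_comm (eval x n)]

theorem derivative_div {n : ℂ[X]} (hn : n ≠ 0) :
    IsRationalWithLimit (fun x => (derivative n).eval x / n.eval x) 0 := by
  refine ⟨derivative n, n, hn, (natDegree_derivative_le n).trans (Nat.sub_le _ _), ?_, by simp⟩
  rw [coeff_derivative, coeff_eq_zero_of_natDegree_lt (Nat.lt_succ_self _), zero_mul, zero_mul]

end IsRationalWithLimit

theorem meromorphicOrderAt_eval {p : ℂ[X]} (hp : p ≠ 0) (z : ℂ) :
    meromorphicOrderAt (fun x => p.eval x) z = ((p.rootMultiplicity z : ℕ) : ℤ) := by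
  rw [meromorphicOrderAt_eq_int_iff (p.differentiable.analyticAt z).meromorphicAt]
  obtain ⟨q, hq, hdvd⟩ := exists_eq_pow_rootMultiplicity_mul_and_not_dvd p hp z
  refine ⟨fun x => q.eval x, q.differentiable.analyticAt z, ?_, ?_⟩
  · rwa [dvd_iff_isRoot] at hdvd
  · refine Eventually.of_forall fun x => ?_
    conv_lhs => rw [hq]
    simp

theorem dvd_of_forall_meromorphicOrderAt_div_nonneg {n d : ℂ[X]} (hd : d ≠ 0)
    (h : ∀ z, 0 ≤ meromorphicOrderAt ((fun x => n.eval x) / fun x => d.eval x) z) : d ∣ n := by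
  rcases eq_or_ne n 0 with rfl | hn
  · exact dvd_zero d
  rw [(IsAlgClosed.splits d).dvd_iff_roots_le_roots hd hn, Multiset.le_iff_count]
  intro z
  have hz := h z
  rw [meromorphicOrderAt_div (n.differentiable.analyticAt z).meromorphicAt
    (d.differentiable.analyticAt z).meromorphicAt, meromorphicOrderAt_eval hn,
    meromorphicOrderAt_eval hd] at hz
  rw [count_roots, count_roots]
  have hz' : (0 : ℤ) ≤ (n.rootMultiplicity z : ℤ) - (d.rootMultiplicity z : ℤ) :=
    mod_cast hz
  lia

theorem IsRationalWithLimit.exists_polynomial {b : ℂ → ℂ} {q : ℂ} (hb : IsRationalWithLimit b q)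
    {P : ℂ[X]} (hP : P.Monic)
    (hord : ∀ z, 0 ≤ meromorphicOrderAt (fun x => P.eval x * b x) z) :
    ∃ A : ℂ[X], A.natDegree ≤ P.natDegree ∧ A.coeff P.natDegree = q ∧
      ∀ᶠ x in cofinite, P.eval x * b x = A.eval x := by
  obtain ⟨n, d, hd, hdeg, hcoeff, heval⟩ := hb
  have hdvd : d ∣ n * P := by
    refine dvd_of_forall_meromorphicOrderAt_div_nonneg hd fun z => ?_
    refine (hord z).trans_eq (meromorphicOrderAt_congr ?_)
    filter_upwards [nhdsNE_le_cofinite z heval] with x hx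
    rw [show b x = _ from hx, Pi.div_apply, eval_mul]
    ring
  obtain ⟨A, hA⟩ := hdvd
  have hAdeg : A.natDegree ≤ P.natDegree := by
    rcases eq_or_ne A 0 with rfl | hA0
    · simp
    have hle : d.natDegree + A.natDegree ≤ n.natDegree + P.natDegree := by
      rw [← natDegree_mul hd hA0, ← hA]
      exact natDegree_mul_le
    lia
  refine ⟨A, hAdeg, ?_, ?_⟩
  · have htop := congrArg (fun r => r.coeff (d.natDegree + P.natDegree)) hA
    simp only [coeff_mul_add_eq_of_natDegree_le hdeg le_rfl,
      coeff_mul_add_eq_of_natDegree_le le_rfl hAdeg, hcoeff, coeff_natDegree, hP.leadingCoeff,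
      mul_one] at htop
    rw [mul_comm] at htop
    exact (mul_left_cancel₀ (leadingCoeff_ne_zero.2 hd) htop).symm
  · filter_upwards [heval, eventually_eval_ne_zero hd] with x hbx hx
    rw [hbx, mul_div_assoc', div_eq_iff hx, mul_comm, ← eval_mul, hA, eval_mul, mul_comm]

/-! ### Wronskians of quasi-polynomials -/

section Wronskian

variable {N : ℕ}

/-- The polynomial factor of a generalized Wronskian of quasi-polynomials, the other factor being
an exponential. -/
noncomputable def wronskianPoly (l : Fin N → ℂ) (p : Fin N → ℂ[X]) (d : Fin N → ℕ) : ℂ[X] :=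
  (Matrix.of fun a b : Fin N => (twistedDeriv (l a) ^ d b) (p a)).det

theorem genWronskian_expPoly (l : Fin N → ℂ) (p : Fin N → ℂ[X]) (d : Fin N → ℕ) (x : ℂ) :
    genWronskian (fun a => expPoly (l a) (p a)) d x =
      (∏ a, Complex.exp (l a * x)) * (wronskianPoly l p d).eval x := by
  rw [wronskianPoly, ← coe_evalRingHom, RingHom.map_det, ← Matrix.det_mul_column, genWronskian]
  congr 1
  ext a b
  rw [Matrix.of_apply, iteratedDeriv_expPoly]
  simp [expPoly, mul_comm]

theorem wronskianPoly_ne_zero {l : Fin N → ℂ} {p : Fin N → ℂ[X]}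
    (h : LinearIndependent ℂ fun a => expPoly (l a) (p a)) :
    wronskianPoly l p (fun b => (b : ℕ)) ≠ 0 := by
  intro hzero
  obtain ⟨x, hx⟩ := exists_wronskian_ne_zero (fun a => expPoly_mem_entire _ _) h
  rw [wronskian, genWronskian_expPoly, hzero, eval_zero, mul_zero] at hx
  exact hx rfl

theorem eventually_wronskian_expPoly_ne_zero {l : Fin N → ℂ} {p : Fin N → ℂ[X]}
    (h : LinearIndependent ℂ fun a => expPoly (l a) (p a)) :
    ∀ᶠ x in cofinite, wronskian (fun a => expPoly (l a) (p a)) x ≠ 0 := by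
  filter_upwards [eventually_eval_ne_zero (wronskianPoly_ne_zero h)] with x hx
  rw [wronskian, genWronskian_expPoly]
  exact mul_ne_zero (Finset.prod_ne_zero_iff.2 fun _ _ => Complex.exp_ne_zero _) hx

theorem logDeriv_exp_mul_eval_div {n d : ℂ[X]} {m x : ℂ} (hn : n.eval x ≠ 0)
    (hd : d.eval x ≠ 0) :
    logDeriv (fun x => Complex.exp (m * x) * (n.eval x / d.eval x)) x =
      m + ((derivative n).eval x / n.eval x - (derivative d).eval x / d.eval x) := by
  have hexp : HasDerivAt (fun x : ℂ => Complex.exp (m * x)) (Complex.exp (m * x) * (m * 1)) x :=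
    ((hasDerivAt_id x).const_mul m).cexp
  rw [logDeriv_mul (f := fun x => Complex.exp (m * x)) (g := fun x => n.eval x / d.eval x) x
      (Complex.exp_ne_zero _) (div_ne_zero hn hd) hexp.differentiableAt
      (n.differentiableAt.fun_div d.differentiableAt hd),
    logDeriv_div x hn hd n.differentiableAt d.differentiableAt, logDeriv_apply, logDeriv_apply,
    logDeriv_apply, hexp.deriv, Polynomial.deriv, Polynomial.deriv, mul_one,
    mul_div_cancel_left₀ _ (Complex.exp_ne_zero _)]

theorem monicOp_init_expPoly (l : Fin (N + 1) → ℂ) (p : Fin (N + 1) → ℂ[X]) :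
    monicOp (fun a => expPoly (Fin.init l a) (Fin.init p a))
        (expPoly (l (Fin.last N)) (p (Fin.last N))) = fun x =>
      Complex.exp (l (Fin.last N) * x) * ((wronskianPoly l p (fun b => (b : ℕ))).eval x /
        (wronskianPoly (Fin.init l) (Fin.init p) (fun b => (b : ℕ))).eval x) := by
  refine (monicOp_init fun a => expPoly (l a) (p a)).trans (funext fun x => ?_)
  rw [wronskian, wronskian, genWronskian_expPoly,
    show genWronskian (Fin.init fun a => expPoly (l a) (p a)) (fun b => (b : ℕ)) x = _ from
      genWronskian_expPoly (Fin.init l) (Fin.init p) _ x, Fin.prod_univ_castSucc, mul_assoc]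
  simp only [Fin.init_def]
  rw [mul_div_mul_left _ _ (Finset.prod_ne_zero_iff.2 fun _ _ => Complex.exp_ne_zero _),
    mul_div_assoc]

theorem isRationalWithLimit_stepCoeff {f : Fin N → ℂ → ℂ} {h : ℂ → ℂ} {P : ℂ[X]} {m : ℂ}
    (hP : P.natDegree ≤ N) (hf : ∀ k : Fin (N + 1), IsRationalWithLimit (opCoeff f k) (P.coeff k))
    (hh : IsRationalWithLimit (logDeriv h) m) (k : Fin (N + 2)) :
    IsRationalWithLimit (stepCoeff f h k) ((P * (X - C m)).coeff k) := by
  have hcoeff : (P * (X - C m)).coeff k = (P * X).coeff k + (0 - m * P.coeff k) := by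
    rw [mul_sub, coeff_sub, coeff_mul_C]
    ring
  rw [hcoeff]
  refine IsRationalWithLimit.add ?_ ?_
  · induction k using Fin.cases with
    | zero =>
      rw [Fin.cons_zero, Fin.val_zero, mul_coeff_zero, coeff_X_zero, mul_zero]
      exact .const 0
    | succ j =>
      rw [Fin.cons_succ, Fin.val_succ, coeff_mul_X]
      exact hf j
  · induction k using Fin.lastCases with
    | last =>
      rw [Fin.snoc_last, Fin.val_last, coeff_eq_zero_of_natDegree_lt (Nat.lt_succ_of_le hP),
        mul_zero, sub_zero]
      exact .const 0
    | cast j =>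
      rw [Fin.snoc_castSucc, Fin.val_castSucc]
      exact (hf j).deriv.sub (hh.mul (hf j))

theorem isRationalWithLimit_logDeriv_monicOp {l : Fin (N + 1) → ℂ} {p : Fin (N + 1) → ℂ[X]}
    (hind : LinearIndependent ℂ fun a => expPoly (l a) (p a)) :
    IsRationalWithLimit (logDeriv (monicOp (fun a => expPoly (Fin.init l a) (Fin.init p a))
      (expPoly (l (Fin.last N)) (p (Fin.last N))))) (l (Fin.last N)) := by
  have hW := wronskianPoly_ne_zero hind
  have hW' : wronskianPoly (Fin.init l) (Fin.init p) (fun b => (b : ℕ)) ≠ 0 :=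
    wronskianPoly_ne_zero (hind.comp _ (Fin.castSucc_injective N))
  have hlim := (IsRationalWithLimit.const (l (Fin.last N))).add
    ((IsRationalWithLimit.derivative_div hW).sub (.derivative_div hW'))
  rw [sub_zero, add_zero] at hlim
  rw [monicOp_init_expPoly]
  refine hlim.congr ?_
  filter_upwards [eventually_eval_ne_zero hW, eventually_eval_ne_zero hW'] with x hx hx'
  exact logDeriv_exp_mul_eval_div hx hx'

theorem isRationalWithLimit_opCoeff {l : Fin N → ℂ} {p : Fin N → ℂ[X]}
    (hind : LinearIndependent ℂ fun a => expPoly (l a) (p a)) (k : Fin (N + 1)) :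
    IsRationalWithLimit (opCoeff (fun a => expPoly (l a) (p a)) k)
      ((∏ a, (X - C (l a))).coeff k) := by
  induction N with
  | zero =>
    obtain rfl : k = Fin.last 0 := Subsingleton.elim (α := Fin 1) k _
    have hone : opCoeff (fun a => expPoly (l a) (p a)) (Fin.last 0) = fun _ => 1 := by
      funext x
      rw [opCoeff_last]
      simp [wronskian, genWronskian]
    rw [hone, Fin.prod_univ_zero, Fin.val_last, coeff_one_zero]
    exact .const 1
  | succ N ih =>
    have hind' : LinearIndependent ℂ fun a => expPoly (Fin.init l a) (Fin.init p a) :=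
      hind.comp _ (Fin.castSucc_injective N)
    have hdeg : (∏ a, (X - C (Fin.init l a))).natDegree ≤ N := by
      rw [natDegree_prod_of_monic _ _ fun a _ => monic_X_sub_C _]
      simp
    rw [Fin.prod_univ_castSucc]
    refine (isRationalWithLimit_stepCoeff hdeg (ih hind')
      (isRationalWithLimit_logDeriv_monicOp hind) k).congr ?_
    filter_upwards [eventually_wronskian_expPoly_ne_zero hind,
      eventually_wronskian_expPoly_ne_zero hind'] with x hx hx'
    exact opCoeff_eq_stepCoeff (f := fun a => expPoly (l a) (p a))
      (fun a => expPoly_mem_entire _ _) hx hx' k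

end Wronskian

/-! ### Singular points -/

theorem meromorphicOrderAt_eq_coe_iff_of_mem_entire {y : ℂ → ℂ} (hy : y ∈ entire) (z : ℂ)
    (e : ℕ) : meromorphicOrderAt y z = ((e : ℤ) : WithTop ℤ) ↔
      (∀ b < e, iteratedDeriv b y z = 0) ∧ iteratedDeriv e y z ≠ 0 := by
  have han := analyticAt_of_mem_entire hy z
  rw [← analyticOrderAt_eq_nat_iff_iteratedDeriv_eq_zero han, han.meromorphicOrderAt_eq]
  cases analyticOrderAt y z with
  | top => simp
  | coe n =>
    rw [ENat.map_natCast]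
    norm_cast

theorem exists_natCast_meromorphicOrderAt_of_mem_entire {y : ℂ → ℂ} (hy : y ∈ entire)
    (hy0 : y ≠ 0) (z : ℂ) : ∃ e : ℕ, meromorphicOrderAt y z = ((e : ℤ) : WithTop ℤ) := by
  have htop : meromorphicOrderAt y z ≠ ⊤ := fun h =>
    hy0 (eq_zero_of_mem_entire_of_eventually hy (meromorphicOrderAt_eq_top_iff.1 h))
  have hnonneg := (analyticAt_of_mem_entire hy z).meromorphicOrderAt_nonneg
  lift meromorphicOrderAt y z to ℤ using htop with n
  lift n to ℕ using mod_cast hnonneg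
  exact ⟨n, rfl⟩

theorem mem_exponents_iff {V : Submodule ℂ (ℂ → ℂ)} (hV : V ≤ entire) {z : ℂ} {e : ℤ} :
    e ∈ exponents V z ↔ ∃ n : ℕ, (n : ℤ) = e ∧
      ∃ y ∈ V, (∀ b < n, iteratedDeriv b y z = 0) ∧ iteratedDeriv n y z ≠ 0 := by
  constructor
  · rintro ⟨y, hy, he⟩
    have hnonneg := (analyticAt_of_mem_entire (hV hy) z).meromorphicOrderAt_nonneg
    rw [he] at hnonneg
    lift e to ℕ using mod_cast hnonneg
    exact ⟨e, rfl, y, hy, (meromorphicOrderAt_eq_coe_iff_of_mem_entire (hV hy) z e).1 he⟩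
  · rintro ⟨n, rfl, y, hy, hn⟩
    exact ⟨y, hy, (meromorphicOrderAt_eq_coe_iff_of_mem_entire (hV hy) z n).2 hn⟩

theorem iteratedDeriv_sum_smul_eq_vecMul {N : ℕ} {f : Fin N → ℂ → ℂ} (hf : ∀ a, f a ∈ entire)
    (c : Fin N → ℂ) (z : ℂ) (b : Fin N) :
    iteratedDeriv (b : ℕ) (∑ a, c a • f a) z = Matrix.vecMul c (wronskianMatrix f z) b := by
  rw [iteratedDeriv_sum_smul _ hf]
  rfl

/-- The common denominator of the coefficients of the monic operator of `V`, when `S` is the set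
of singular points. -/
noncomputable def polePoly (V : Submodule ℂ (ℂ → ℂ)) (S : Finset ℂ) : ℂ[X] :=
  ∏ z ∈ S, (X - C z) ^ poleOrder V z

theorem monic_polePoly (V : Submodule ℂ (ℂ → ℂ)) (S : Finset ℂ) : (polePoly V S).Monic :=
  monic_prod_of_monic _ _ fun _ _ => (monic_X_sub_C _).pow _

theorem natDegree_polePoly (V : Submodule ℂ (ℂ → ℂ)) (S : Finset ℂ) :
    (polePoly V S).natDegree = ∑ z ∈ S, poleOrder V z := by
  rw [polePoly, natDegree_prod_of_monic _ _ fun _ _ => (monic_X_sub_C _).pow _]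
  simp

theorem eval_polePoly (V : Submodule ℂ (ℂ → ℂ)) (S : Finset ℂ) (x : ℂ) :
    (polePoly V S).eval x = ∏ z ∈ S, (x - z) ^ poleOrder V z := by
  simp [polePoly, eval_prod]

namespace IsEntireBasis

variable {N : ℕ} {V : Submodule ℂ (ℂ → ℂ)} {f : Fin N → ℂ → ℂ}

theorem exists_mem_exponents_ge (h : IsEntireBasis V f) {z : ℂ} (hz : wronskian f z = 0) :
    ∃ e ∈ exponents V z, (N : ℤ) ≤ e := by
  obtain ⟨c, hc, hcM⟩ := Matrix.exists_vecMul_eq_zero_iff.2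
    (show (wronskianMatrix f z).det = 0 from hz)
  have hyV : ∑ a, c a • f a ∈ V := h.mem_iff.2 ⟨c, rfl⟩
  have hy0 : ∑ a, c a • f a ≠ 0 := fun h0 =>
    hc (funext (Fintype.linearIndependent_iff.1 h.linearIndependent c h0))
  have hye := h.le_entire hyV
  obtain ⟨e, he⟩ := exists_natCast_meromorphicOrderAt_of_mem_entire hye hy0 z
  refine ⟨e, ⟨_, hyV, he⟩, ?_⟩
  by_contra! hlt
  have heN : e < N := by exact_mod_cast hlt
  refine ((meromorphicOrderAt_eq_coe_iff_of_mem_entire hye z e).1 he).2 ?_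
  rw [iteratedDeriv_sum_smul_eq_vecMul h.mem_entire c z ⟨e, heN⟩, hcM, Pi.zero_apply]

theorem lt_of_mem_exponents (h : IsEntireBasis V f) {z : ℂ} (hz : wronskian f z ≠ 0) {e : ℤ}
    (he : e ∈ exponents V z) : e < N := by
  obtain ⟨n, rfl, y, hyV, hlow, hn⟩ := (mem_exponents_iff h.le_entire).1 he
  by_contra! hle
  obtain ⟨c, rfl⟩ := h.mem_iff.1 hyV
  have hcM : Matrix.vecMul c (wronskianMatrix f z) = 0 := funext fun b => by
    rw [← iteratedDeriv_sum_smul_eq_vecMul h.mem_entire]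
    exact hlow b (by lia)
  simp [Matrix.eq_zero_of_vecMul_eq_zero hz hcM] at hn

theorem natCast_mem_exponents (h : IsEntireBasis V f) {z : ℂ} (hz : wronskian f z ≠ 0) {e : ℕ}
    (heN : e < N) : (e : ℤ) ∈ exponents V z := by
  have hdet : IsUnit (wronskianMatrix f z).det := isUnit_iff_ne_zero.2 hz
  set c : Fin N → ℂ := Matrix.vecMul (Pi.single ⟨e, heN⟩ 1) (wronskianMatrix f z)⁻¹ with hc
  have hderiv : ∀ b : Fin N, iteratedDeriv (b : ℕ) (∑ a, c a • f a) z =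
      (Pi.single ⟨e, heN⟩ 1 : Fin N → ℂ) b := fun b => by
    rw [iteratedDeriv_sum_smul_eq_vecMul h.mem_entire, hc, Matrix.vecMul_vecMul,
      Matrix.nonsing_inv_mul _ hdet, Matrix.vecMul_one]
  refine (mem_exponents_iff h.le_entire).2 ⟨e, rfl, _, h.mem_iff.2 ⟨c, rfl⟩, fun b hb => ?_, ?_⟩
  · rw [hderiv ⟨b, hb.trans heN⟩, Pi.single_eq_of_ne (Fin.ne_of_lt hb)]
  · rw [hderiv ⟨e, heN⟩, Pi.single_eq_same]
    exact one_ne_zero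

theorem exponents_eq_iff (h : IsEntireBasis V f) (z : ℂ) :
    exponents V z = Set.Ico (0 : ℤ) N ↔ wronskian f z ≠ 0 := by
  constructor
  · intro hexp hz
    obtain ⟨e, he, hle⟩ := h.exists_mem_exponents_ge hz
    rw [hexp] at he
    exact hle.not_gt he.2
  · intro hz
    refine Set.Subset.antisymm (fun e he => ⟨?_, h.lt_of_mem_exponents hz he⟩) ?_
    · obtain ⟨n, rfl, -⟩ := (mem_exponents_iff h.le_entire).1 he
      exact Int.natCast_nonneg n
    · rintro e ⟨he, heN⟩
      lift e to ℕ using he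
      exact h.natCast_mem_exponents hz (mod_cast heN)

theorem mem_singularPoints_iff (h : IsEntireBasis V f) {z : ℂ} :
    z ∈ singularPoints V ↔ wronskian f z = 0 := by
  rw [singularPoints, Set.mem_ofPred_eq, h.finrank_eq, Ne, h.exponents_eq_iff, not_not]

theorem notMem_singularPoints_iff (h : IsEntireBasis V f) {z : ℂ} :
    z ∉ singularPoints V ↔ wronskian f z ≠ 0 := not_congr h.mem_singularPoints_iff

theorem poleOrder_eq (h : IsEntireBasis V f) (z : ℂ) : poleOrder V z =
    sInf {m : ℕ | ∀ k, 0 ≤ meromorphicOrderAt (fun x => (x - z) ^ m * opCoeff f k x) z} := by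
  have := h.finiteDimensional
  obtain rfl := h.finrank_eq
  have hcoeff : ∀ k, monicCoeff V k = opCoeff f k := fun k =>
    congrFun (h.opCoeff_eq (isEntireBasis_basisOf h.le_entire)) k
  simp only [poleOrder, hcoeff]

theorem meromorphicOrderAt_pow_mul_opCoeff_nonneg (h : IsEntireBasis V f) (z : ℂ)
    (k : Fin (N + 1)) : 0 ≤ meromorphicOrderAt (fun x => (x - z) ^ N * opCoeff f k x) z :=
  (((OrderAtLeast.sub_pow z N).mul
    (orderAtLeast_opCoeff h.mem_entire h.linearIndependent z k)).mono
    (by lia : (0 : ℤ) ≤ N + ((k : ℕ) - N))).le_order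

theorem poleOrder_le (h : IsEntireBasis V f) (z : ℂ) : poleOrder V z ≤ N := by
  rw [h.poleOrder_eq]
  exact Nat.sInf_le (h.meromorphicOrderAt_pow_mul_opCoeff_nonneg z)

theorem meromorphicOrderAt_pow_poleOrder_mul_opCoeff_nonneg (h : IsEntireBasis V f) (z : ℂ)
    (k : Fin (N + 1)) :
    0 ≤ meromorphicOrderAt (fun x => (x - z) ^ poleOrder V z * opCoeff f k x) z := by
  rw [h.poleOrder_eq]
  exact Nat.sInf_mem (s := {m : ℕ | ∀ k, 0 ≤ meromorphicOrderAt
    (fun x => (x - z) ^ m * opCoeff f k x) z})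
    ⟨N, h.meromorphicOrderAt_pow_mul_opCoeff_nonneg z⟩ k

theorem meromorphicOrderAt_polePoly_mul_opCoeff_nonneg (h : IsEntireBasis V f) {S : Finset ℂ}
    (hS : ∀ z, z ∈ S ↔ z ∈ singularPoints V) (z : ℂ) (k : Fin (N + 1)) :
    0 ≤ meromorphicOrderAt (fun x => (polePoly V S).eval x * opCoeff f k x) z := by
  classical
  by_cases hz : z ∈ S
  · set R := ∏ w ∈ S.erase z, (X - C w) ^ poleOrder V w with hR
    have hfactor : (fun x => (polePoly V S).eval x * opCoeff f k x) =
        (fun x => R.eval x) * fun x => (x - z) ^ poleOrder V z * opCoeff f k x := by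
      funext x
      rw [Pi.mul_apply, polePoly, ← Finset.mul_prod_erase S _ hz, ← hR]
      simp only [eval_mul, eval_pow, eval_sub, eval_X, eval_C]
      ring
    have hmero : MeromorphicAt (fun x => (x - z) ^ poleOrder V z * opCoeff f k x) z :=
      MeromorphicAt.mul (by fun_prop) (meromorphicAt_opCoeff h.mem_entire k z)
    have hRan := R.differentiable.analyticAt z
    rw [hfactor, meromorphicOrderAt_mul hRan.meromorphicAt hmero]
    exact add_nonneg hRan.meromorphicOrderAt_nonneg
      (h.meromorphicOrderAt_pow_poleOrder_mul_opCoeff_nonneg z k)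
  · rw [hS, h.notMem_singularPoints_iff] at hz
    exact (((polePoly V S).differentiable.analyticAt z).mul
      (analyticAt_opCoeff h.mem_entire hz k)).meromorphicOrderAt_nonneg

end IsEntireBasis

namespace IsExpPolyBasis

variable {N : ℕ} {V : Submodule ℂ (ℂ → ℂ)} {l : Fin N → ℂ} {p : Fin N → ℂ[X]}

theorem finite_singularPoints (h : IsExpPolyBasis V l p) : (singularPoints V).Finite := by
  refine (Filter.eventually_cofinite.1
    (eventually_wronskian_expPoly_ne_zero h.linearIndependent)).subset fun z hz => ?_
  exact not_not.2 (h.mem_singularPoints_iff.1 hz)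

theorem exists_polePoly_mul_opCoeff_eq_eval (h : IsExpPolyBasis V l p) {S : Finset ℂ}
    (hS : ∀ z, z ∈ S ↔ z ∈ singularPoints V) :
    ∃ A : Fin (N + 1) → ℂ[X], (∀ k, (A k).natDegree ≤ (polePoly V S).natDegree) ∧
      (∀ k, (A k).coeff (polePoly V S).natDegree = (∏ a, (X - C (l a))).coeff k) ∧
      ∀ k x, x ∉ S → (polePoly V S).eval x * opCoeff (fun a => expPoly (l a) (p a)) k x =
        (A k).eval x := by
  choose A hdeg hcoeff heval using fun k =>
    (isRationalWithLimit_opCoeff h.linearIndependent k).exists_polynomial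
      (monic_polePoly V S) fun z => h.meromorphicOrderAt_polePoly_mul_opCoeff_nonneg hS z k
  refine ⟨A, hdeg, hcoeff, fun k x hx => ?_⟩
  rw [hS, h.notMem_singularPoints_iff] at hx
  have hcont : ContinuousAt (fun x => (polePoly V S).eval x *
      opCoeff (fun a => expPoly (l a) (p a)) k x) x :=
    (polePoly V S).continuousAt.mul (analyticAt_opCoeff h.mem_entire hx k).continuousAt
  exact ((hcont.eventuallyEq_nhds_iff_eventuallyEq_nhdsNE (A k).continuousAt).1
    (nhdsNE_le_cofinite x (heval k))).eq_of_nhds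

end IsExpPolyBasis

/-! ### Contour integrals -/

/-- `f` is holomorphic on the closed disc of radius `r` around `z`, except for at most a pole
at `z`. -/
structure HolomorphicOffCenter (f : ℂ → ℂ) (z : ℂ) (r : ℝ) : Prop where
  differentiableAt : ∀ x ∈ Metric.closedBall z r \ {z}, DifferentiableAt ℂ f x
  meromorphicAt : MeromorphicAt f z

/-- The integral `u ↦ ∮ e^{ux} f(x) dx` over the circle of radius `r` around `z`, which is the
form of the generators of the dual space. -/
noncomputable def circleTransform (f : ℂ → ℂ) (z : ℂ) (r : ℝ) (u : ℂ) : ℂ :=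
  ∮ x in C(z, r), Complex.exp (u * x) * f x

theorem sphere_subset_closedBall_diff_singleton {z : ℂ} {r : ℝ} (hr : 0 < r) :
    Metric.sphere z r ⊆ Metric.closedBall z r \ {z} := fun _ hx =>
  ⟨Metric.sphere_subset_closedBall hx, Metric.ne_of_mem_sphere hx hr.ne'⟩

theorem orderAtLeast_exp_sub_sum (u z : ℂ) (m : ℕ) :
    OrderAtLeast m (fun x => Complex.exp (u * (x - z)) -
      ∑ i ∈ Finset.range m, (u * (x - z)) ^ i / i.factorial) z := by
  obtain ⟨F, hF, hexp⟩ := AnalyticAt.exists_eq_sum_add_pow_mul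
    (by fun_prop : AnalyticAt ℂ Complex.exp 0) m
  have hfactor : (fun x => Complex.exp (u * (x - z)) -
      ∑ i ∈ Finset.range m, (u * (x - z)) ^ i / i.factorial) =
      (fun x => (x - z) ^ m) * fun x => u ^ m * F (u * (x - z)) := by
    funext x
    rw [hexp (u * (x - z))]
    simp only [iteratedDeriv_eq_iterate, Complex.iter_deriv_exp, Complex.exp_zero, smul_eq_mul,
      Pi.mul_apply, mul_one]
    rw [add_sub_cancel_left, mul_pow, mul_assoc, mul_left_comm]
  have hF' : AnalyticAt ℂ (fun x => u ^ m * F (u * (x - z))) z := by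
    refine analyticAt_const.mul (AnalyticAt.fun_comp (g := F) ?_ (by fun_prop))
    rwa [sub_self, mul_zero]
  rw [hfactor, ← add_zero (m : ℤ)]
  exact (OrderAtLeast.sub_pow z m).mul (.of_analyticAt hF')

namespace HolomorphicOffCenter

variable {f g : ℂ → ℂ} {z : ℂ} {r : ℝ}

theorem add (hf : HolomorphicOffCenter f z r) (hg : HolomorphicOffCenter g z r) :
    HolomorphicOffCenter (f + g) z r :=
  ⟨fun x hx => (hf.differentiableAt x hx).add (hg.differentiableAt x hx),
    hf.meromorphicAt.add hg.meromorphicAt⟩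

theorem mul (hf : HolomorphicOffCenter f z r) (hg : HolomorphicOffCenter g z r) :
    HolomorphicOffCenter (f * g) z r :=
  ⟨fun x hx => (hf.differentiableAt x hx).mul (hg.differentiableAt x hx),
    hf.meromorphicAt.mul hg.meromorphicAt⟩

theorem of_differentiable (hf : Differentiable ℂ f) (z : ℂ) (r : ℝ) :
    HolomorphicOffCenter f z r :=
  ⟨fun x _ => hf x, (hf.analyticAt z).meromorphicAt⟩

theorem sub_zpow (z : ℂ) (r : ℝ) (n : ℤ) : HolomorphicOffCenter (fun x => (x - z) ^ n) z r :=
  ⟨fun _ hx => (differentiableAt_id.sub_const z).zpow (Or.inl (sub_ne_zero.2 hx.2)),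
    by fun_prop⟩

theorem continuousOn_sphere (hf : HolomorphicOffCenter f z r) (hr : 0 < r) :
    ContinuousOn f (Metric.sphere z r) := fun x hx =>
  (hf.differentiableAt x
    (sphere_subset_closedBall_diff_singleton hr hx)).continuousAt.continuousWithinAt

theorem circleIntegrable (hf : HolomorphicOffCenter f z r) (hr : 0 < r) :
    CircleIntegrable f z r := (hf.continuousOn_sphere hr).circleIntegrable hr.le

theorem circleIntegral_eq (hf : HolomorphicOffCenter f z r) (hr : 0 < r) {y : ℂ}
    (hy : Tendsto (fun x => (x - z) * f x) (𝓝[≠] z) (𝓝 y)) :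
    ∮ x in C(z, r), f x = (2 * Real.pi * Complex.I : ℂ) * y := by
  have hdiff : ∀ x ∈ Metric.closedBall z r \ {z}, DifferentiableAt ℂ (fun x => (x - z) * f x) x :=
    fun x hx => (differentiableAt_id.sub_const z).mul (hf.differentiableAt x hx)
  have hcauchy :=
    Complex.circleIntegral_sub_center_inv_smul_of_differentiable_on_off_countable_of_tendsto hr
      Set.countable_empty (fun x hx => (hdiff x hx).continuousAt.continuousWithinAt)
      (fun x hx => hdiff x ⟨Metric.ball_subset_closedBall hx.1.1, hx.1.2⟩) hy
  rw [smul_eq_mul] at hcauchy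
  rw [← hcauchy]
  refine circleIntegral.integral_congr hr.le fun x hx => ?_
  have hxz : x - z ≠ 0 := sub_ne_zero.2 (sphere_subset_closedBall_diff_singleton hr hx).2
  exact (inv_mul_cancel_left₀ hxz (f x)).symm

theorem circleIntegral_eq_zero (hf : HolomorphicOffCenter f z r) (hr : 0 < r)
    (hord : 0 ≤ meromorphicOrderAt f z) : ∮ x in C(z, r), f x = 0 := by
  rw [hf.circleIntegral_eq hr (y := 0), mul_zero]
  obtain ⟨g, hg, hfg⟩ := hf.meromorphicAt.meromorphicOrderAt_nonneg_iff.1 hord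
  have hlim : Tendsto (fun x => (x - z) * g x) (𝓝[≠] z) (𝓝 ((z - z) * g z)) :=
    ((continuousAt_id.sub continuousAt_const).mul hg.continuousAt).tendsto.mono_left
      nhdsWithin_le_nhds
  rw [sub_self, zero_mul] at hlim
  refine hlim.congr' ?_
  filter_upwards [hfg] with x hx using by rw [hx]

theorem circleIntegral_sub_zpow_mul_ne_zero (hf : HolomorphicOffCenter f z r) (hr : 0 < r) {n : ℤ}
    (hn : meromorphicOrderAt f z = n) : ∮ x in C(z, r), (x - z) ^ (-n - 1) * f x ≠ 0 := by
  obtain ⟨g, hg, hg0, hfg⟩ := (meromorphicOrderAt_eq_int_iff hf.meromorphicAt).1 hn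
  have hlim : Tendsto (fun x => (x - z) * ((x - z) ^ (-n - 1) * f x)) (𝓝[≠] z) (𝓝 (g z)) := by
    refine (hg.continuousAt.tendsto.mono_left nhdsWithin_le_nhds).congr' ?_
    filter_upwards [hfg, self_mem_nhdsWithin] with x hx hxz
    have hxz' : x - z ≠ 0 := sub_ne_zero.2 hxz
    rw [hx, smul_eq_mul, ← mul_assoc, ← mul_assoc, ← zpow_one_add₀ hxz', ← zpow_add₀ hxz',
      show 1 + (-n - 1) + n = 0 by ring, zpow_zero, one_mul]
  have hintegral := ((sub_zpow z r (-n - 1)).mul hf).circleIntegral_eq hr hlim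
  simp only [Pi.mul_apply] at hintegral
  rw [hintegral]
  exact mul_ne_zero Complex.two_pi_I_ne_zero hg0

theorem exists_orderAtLeast_neg (hf : HolomorphicOffCenter f z r) :
    ∃ m : ℕ, OrderAtLeast (-m) f z := by
  cases hord : meromorphicOrderAt f z with
  | top => exact ⟨0, hf.meromorphicAt, hord ▸ le_top⟩
  | coe n => exact ⟨n.natAbs, hf.meromorphicAt, hord ▸ WithTop.coe_le_coe.2 (by lia)⟩

theorem circleIntegral_exp_sub_mul (hf : HolomorphicOffCenter f z r) (hr : 0 < r) {m : ℕ}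
    (hm : OrderAtLeast (-m) f z) (u : ℂ) :
    ∮ x in C(z, r), Complex.exp (u * (x - z)) * f x =
      ∑ i ∈ Finset.range m, u ^ i / i.factorial * ∮ x in C(z, r), (x - z) ^ i * f x := by
  set T : ℂ → ℂ := fun x => ∑ i ∈ Finset.range m, (u * (x - z)) ^ i / i.factorial with hT
  set E : ℂ → ℂ := fun x => Complex.exp (u * (x - z)) - T x with hE
  have hTf : HolomorphicOffCenter (T * f) z r :=
    (of_differentiable (Differentiable.fun_sum fun i _ => by fun_prop) z r).mul hf
  have hEf : HolomorphicOffCenter (E * f) z r :=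
    (of_differentiable (by fun_prop) z r).mul hf
  have hEf_order : OrderAtLeast 0 (E * f) z :=
    ((orderAtLeast_exp_sub_sum u z m).mul hm).mono (by lia)
  have hsplit : ∀ x, Complex.exp (u * (x - z)) * f x = (E * f) x + (T * f) x := fun x => by
    simp only [hE, Pi.mul_apply]
    ring
  have hTf_sum : ∀ x, (T * f) x =
      ∑ i ∈ Finset.range m, u ^ i / i.factorial * ((x - z) ^ i * f x) := fun x => by
    rw [Pi.mul_apply, hT, Finset.sum_mul]
    exact Finset.sum_congr rfl fun i _ => by rw [mul_pow]; ring
  simp only [hsplit]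
  rw [circleIntegral.integral_add (hEf.circleIntegrable hr) (hTf.circleIntegrable hr),
    hEf.circleIntegral_eq_zero hr hEf_order.le_order, zero_add]
  simp only [hTf_sum]
  rw [circleIntegral.integral_fun_sum fun i _ => ?_]
  · simp only [circleIntegral.integral_const_mul]
  · have hpow : HolomorphicOffCenter (fun x => (x - z) ^ i * f x) z r :=
      (of_differentiable (by fun_prop) z r).mul hf
    exact (hpow.circleIntegrable hr).const_smul (a := u ^ i / (i.factorial : ℂ))

theorem circleTransform_eq_expPoly (hf : HolomorphicOffCenter f z r) (hr : 0 < r) {m : ℕ}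
    (hm : OrderAtLeast (-m) f z) : circleTransform f z r =
      expPoly z (∑ i ∈ Finset.range m,
        C ((∮ x in C(z, r), (x - z) ^ i * f x) / i.factorial) * X ^ i) := by
  funext u
  have hexp : ∀ x, Complex.exp (u * x) * f x =
      Complex.exp (u * z) * (Complex.exp (u * (x - z)) * f x) := fun x => by
    rw [← mul_assoc, ← Complex.exp_add]
    ring_nf
  simp only [circleTransform, hexp, circleIntegral.integral_const_mul,
    hf.circleIntegral_exp_sub_mul hr hm, expPoly, LinearMap.coe_mk, AddHom.coe_mk,
    eval_finsetSum, eval_mul, eval_C, eval_pow, eval_X]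
  rw [mul_comm, mul_comm u z]
  congr 1
  exact Finset.sum_congr rfl fun i _ => by ring

theorem exists_circleTransform_eq_expPoly (hf : HolomorphicOffCenter f z r) (hr : 0 < r) :
    ∃ q, circleTransform f z r = expPoly z q := by
  obtain ⟨m, hm⟩ := hf.exists_orderAtLeast_neg
  exact ⟨_, hf.circleTransform_eq_expPoly hr hm⟩

theorem meromorphicOrderAt_nonneg_of_circleTransform_eq_zero (hf : HolomorphicOffCenter f z r)
    (hr : 0 < r) (hzero : circleTransform f z r = 0) : 0 ≤ meromorphicOrderAt f z := by
  by_contra! hneg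
  obtain ⟨m, hm⟩ := hf.exists_orderAtLeast_neg
  obtain ⟨n, hn⟩ := WithTop.ne_top_iff_exists.1 (hneg.trans_le le_top).ne
  have hmn := hm.le_order
  rw [← hn] at hneg hmn
  have hn0 : n < 0 := mod_cast hneg
  have hmn' : -(m : ℤ) ≤ n := WithTop.coe_le_coe.1 hmn
  obtain ⟨i, hi⟩ : ∃ i : ℕ, (i : ℤ) = -n - 1 := ⟨(-n - 1).toNat, by lia⟩
  have him : i < m := by lia
  have hpoly := expPoly_injective z
    ((map_zero _).trans (hzero.symm.trans (hf.circleTransform_eq_expPoly hr hm)))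
  have hcoeff := congrArg (fun q => q.coeff i) hpoly
  simp only [coeff_zero, finsetSum_coeff, coeff_C_mul_X_pow] at hcoeff
  rw [Finset.sum_ite_eq, if_pos (Finset.mem_range.2 him)] at hcoeff
  have hintegral := hf.circleIntegral_sub_zpow_mul_ne_zero hr hn.symm
  simp only [← hi, zpow_natCast] at hintegral
  exact div_ne_zero hintegral (Nat.cast_ne_zero.2 i.factorial_ne_zero) hcoeff.symm

end HolomorphicOffCenter

/-- The space of functions satisfying `HolomorphicOffCenter`, the domain of the linear maps given
by integration over the circle. -/
def holomorphicOffCenter (z : ℂ) (r : ℝ) : Submodule ℂ (ℂ → ℂ) where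
  carrier := {f | HolomorphicOffCenter f z r}
  add_mem' hf hg := hf.add hg
  zero_mem' := .of_differentiable (differentiable_const 0) z r
  smul_mem' c _ hf := (HolomorphicOffCenter.of_differentiable (differentiable_const c) z r).mul hf

/-- The linear form `f ↦ ∮ k(x) f(x) dx` over the circle of radius `r` around `z`. -/
noncomputable def circlePairing {k : ℂ → ℂ} {z : ℂ} {r : ℝ} (hk : HolomorphicOffCenter k z r)
    (hr : 0 < r) : holomorphicOffCenter z r →ₗ[ℂ] ℂ where
  toFun f := ∮ x in C(z, r), k x * (f : ℂ → ℂ) x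
  map_add' f g := by
    simp only [Submodule.coe_add, Pi.add_apply, mul_add]
    exact circleIntegral.integral_add ((hk.mul f.2).circleIntegrable hr)
      ((hk.mul g.2).circleIntegrable hr)
  map_smul' c f := by
    rw [RingHom.id_apply, smul_eq_mul, ← circleIntegral.integral_const_mul]
    simp [mul_left_comm]

/-- `circleTransform` as a linear map. -/
noncomputable def circleTransformₗ (z : ℂ) {r : ℝ} (hr : 0 < r) :
    holomorphicOffCenter z r →ₗ[ℂ] (ℂ → ℂ) :=
  LinearMap.pi fun u => circlePairing (k := fun x => Complex.exp (u * x))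
    (.of_differentiable (by fun_prop) z r) hr

-- The kernel of the transform on `E` consists of functions with order in `[0, k)`, hence embeds
-- into `ℂ ^ k` by means of the `k` residues of `(x - z) ^ (-n - 1) * f x`.
theorem finrank_le_finrank_add_of_circleTransform_mem {E : Type*} [AddCommGroup E] [Module ℂ E]
    {z : ℂ} {r : ℝ} (hr : 0 < r) (R : E →ₗ[ℂ] holomorphicOffCenter z r)
    {K : Submodule ℂ (ℂ → ℂ)} [FiniteDimensional ℂ K] (hK : ∀ e, circleTransform (R e) z r ∈ K)
    {k : ℕ} (hord : ∀ e, e ≠ 0 → circleTransform (R e) z r = 0 →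
      ∃ n < k, meromorphicOrderAt (R e : ℂ → ℂ) z = (n : ℤ)) :
    Module.finrank ℂ E ≤ Module.finrank ℂ K + k := by
  let transform : E →ₗ[ℂ] K := (circleTransformₗ z hr ∘ₗ R).codRestrict K hK
  let residues : E →ₗ[ℂ] (Fin k → ℂ) := LinearMap.pi fun n =>
    circlePairing (.sub_zpow z r (-(n : ℤ) - 1)) hr ∘ₗ R
  have hinj : Function.Injective (transform.prod residues) := by
    refine (injective_iff_map_eq_zero _).2 fun e he => ?_
    by_contra he0
    have htransform : transform e = 0 := congrArg Prod.fst he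
    have hresidues : residues e = 0 := congrArg Prod.snd he
    obtain ⟨n, hn, hord⟩ := hord e he0 (congrArg Subtype.val htransform)
    exact (R e).2.circleIntegral_sub_zpow_mul_ne_zero hr hord (congrFun hresidues ⟨n, hn⟩)
  have hle := LinearMap.finrank_le_finrank_of_injective hinj
  rwa [Module.finrank_prod, Module.finrank_fin_fun] at hle

theorem hasDerivAt_intervalIntegral_of_continuous {F F' : ℂ → ℝ → ℂ}
    (hF : ∀ u, Continuous (F u)) (hF' : Continuous (Function.uncurry F'))
    (hderiv : ∀ u t, HasDerivAt (F · t) (F' u t) u) (a b : ℝ) (u₀ : ℂ) :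
    HasDerivAt (fun u => ∫ t in a..b, F u t) (∫ t in a..b, F' u₀ t) u₀ := by
  obtain ⟨K, hK⟩ := ((isCompact_closedBall u₀ 1).prod
    (isCompact_uIcc (a := a) (b := b))).exists_bound_of_continuousOn hF'.continuousOn
  exact (intervalIntegral.hasDerivAt_integral_of_dominated_loc_of_deriv_le
    (bound := fun _ => K) (Metric.ball_mem_nhds u₀ one_pos)
    (Eventually.of_forall fun u => (hF u).aestronglyMeasurable)
    ((hF u₀).intervalIntegrable _ _)
    (hF'.comp (continuous_const.prodMk continuous_id)).aestronglyMeasurable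
    (Eventually.of_forall fun t ht u hu =>
      hK (u, t) ⟨Metric.ball_subset_closedBall hu, Set.uIoc_subset_uIcc ht⟩)
    intervalIntegrable_const
    (Eventually.of_forall fun t _ u _ => hderiv u t)).2

theorem hasDerivAt_circleTransform {f : ℂ → ℂ} {z : ℂ} {r : ℝ} (hr : 0 ≤ r)
    (hf : ContinuousOn f (Metric.sphere z r)) (u₀ : ℂ) :
    HasDerivAt (circleTransform f z r) (circleTransform (fun x => x * f x) z r u₀) u₀ := by
  have hfc : Continuous fun t : ℝ => f (circleMap z r t) :=
    hf.comp_continuous (continuous_circleMap z r) fun t => circleMap_mem_sphere z hr t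
  have hcirc := continuous_circleMap z r
  have hdcirc : Continuous (deriv (circleMap z r)) := by
    rw [funext (deriv_circleMap z r)]
    exact (continuous_circleMap 0 r).mul continuous_const
  refine hasDerivAt_intervalIntegral_of_continuous
    (fun u => hdcirc.smul (((continuous_const.mul hcirc).cexp).mul hfc))
    (F' := fun u t => deriv (circleMap z r) t •
      (Complex.exp (u * circleMap z r t) * (circleMap z r t * f (circleMap z r t))))
    ((hdcirc.comp continuous_snd).smul (((continuous_fst.mul (hcirc.comp continuous_snd)).cexp).mul
      ((hcirc.mul hfc).comp continuous_snd))) (fun u t => ?_) _ _ u₀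
  have hexp : HasDerivAt (fun u : ℂ => Complex.exp (u * circleMap z r t))
      (Complex.exp (u * circleMap z r t) * (1 * circleMap z r t)) u :=
    ((hasDerivAt_id u).mul_const _).cexp
  refine ((hexp.mul_const _).const_smul (deriv (circleMap z r) t)).congr_deriv ?_
  rw [one_mul, mul_assoc]

theorem iteratedDeriv_circleTransform {f : ℂ → ℂ} {z : ℂ} {r : ℝ} (hr : 0 ≤ r)
    (hf : ContinuousOn f (Metric.sphere z r)) (j : ℕ) :
    iteratedDeriv j (circleTransform f z r) = circleTransform (fun x => x ^ j * f x) z r := by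
  induction j with
  | zero => simp
  | succ j ih =>
    rw [iteratedDeriv_succ, ih]
    funext u
    rw [(hasDerivAt_circleTransform (f := fun x => x ^ j * f x) hr
      ((continuousOn_id.pow j).mul hf) u).deriv]
    simp only [pow_succ', mul_assoc]

/-! ### The conjugate space and its regularization -/

theorem exists_pos_forall_lt_dist {α : Type*} [MetricSpace α] (S : Finset α) (z : α) :
    ∃ r : ℝ, 0 < r ∧ ∀ w ∈ S, w ≠ z → r < dist w z := by
  classical
  have hnhds : ((S.erase z : Finset α) : Set α)ᶜ ∈ 𝓝 z :=
    (S.erase z).finite_toSet.isClosed.isOpen_compl.mem_nhds (by simp)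
  obtain ⟨r, hr, hball⟩ := Metric.nhds_basis_closedBall.mem_iff.1 hnhds
  refine ⟨r, hr, fun w hw hwz => ?_⟩
  by_contra! hle
  exact hball (Metric.mem_closedBall.2 hle) (by simp [hw, hwz])

/-- The factor `∏ (x - z)^(-M_z)` by which elements of the conjugate space are regularized. It is
`0` on `S`, where the product has poles. -/
noncomputable def polePolyInv (V : Submodule ℂ (ℂ → ℂ)) (S : Finset ℂ) (x : ℂ) : ℂ :=
  ((polePoly V S).eval x)⁻¹

theorem eval_polePoly_ne_zero (V : Submodule ℂ (ℂ → ℂ)) {S : Finset ℂ} {x : ℂ} (hx : x ∉ S) :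
    (polePoly V S).eval x ≠ 0 := by
  rw [eval_polePoly, Finset.prod_ne_zero_iff]
  exact fun z hz => pow_ne_zero _ (sub_ne_zero.2 fun h => hx (h ▸ hz))

theorem poleOrder_le_rootMultiplicity_polePoly (V : Submodule ℂ (ℂ → ℂ)) {S : Finset ℂ} {z : ℂ}
    (hz : z ∈ S) : poleOrder V z ≤ (polePoly V S).rootMultiplicity z :=
  (le_rootMultiplicity_iff (monic_polePoly V S).ne_zero).2 (Finset.dvd_prod_of_mem _ hz)

theorem meromorphicAt_polePolyInv (V : Submodule ℂ (ℂ → ℂ)) (S : Finset ℂ) (z : ℂ) :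
    MeromorphicAt (polePolyInv V S) z :=
  ((polePoly V S).differentiable.analyticAt z).meromorphicAt.inv

theorem meromorphicOrderAt_polePolyInv (V : Submodule ℂ (ℂ → ℂ)) (S : Finset ℂ) (z : ℂ) :
    meromorphicOrderAt (polePolyInv V S) z = (-((polePoly V S).rootMultiplicity z : ℤ) : ℤ) := by
  rw [show polePolyInv V S = (fun x => (polePoly V S).eval x)⁻¹ from rfl, meromorphicOrderAt_inv,
    meromorphicOrderAt_eval (monic_polePoly V S).ne_zero]
  rfl

theorem regConjugateSpace_eq_map {V : Submodule ℂ (ℂ → ℂ)} {S : Finset ℂ}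
    (hS : ∀ z, z ∈ S ↔ z ∈ singularPoints V) :
    regConjugateSpace V = (conjugateSpace V).map (LinearMap.mulRight ℂ (polePolyInv V S)) := by
  have hSV : singularPoints V = S := Set.ext fun z => (hS z).symm
  have hprod (x : ℂ) :
      ∏ᶠ z ∈ singularPoints V, ((x - z) ^ poleOrder V z)⁻¹ = polePolyInv V S x := by
    rw [hSV, finprod_mem_coe_finset, polePolyInv, eval_polePoly, Finset.prod_inv_distrib]
  rw [regConjugateSpace, ← Submodule.span_eq (Submodule.map _ _)]
  congr 1
  ext g
  simp only [hprod, Set.mem_ofPred_eq, SetLike.mem_coe, Submodule.mem_map]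
  exact exists_congr fun f => and_congr_right fun _ => eq_comm

namespace IsEntireBasis

variable {m : ℕ} {V : Submodule ℂ (ℂ → ℂ)} {f : Fin (m + 1) → ℂ → ℂ} {g : ℂ → ℂ} {z : ℂ} {r : ℝ}
  {S : Finset ℂ}

theorem differentiableAt_of_mem_conjugateSpace (h : IsEntireBasis V f)
    (hg : g ∈ conjugateSpace V) {x : ℂ} (hx : x ∉ singularPoints V) : DifferentiableAt ℂ g x := by
  rcases eq_or_ne g 0 with rfl | hg0
  · exact differentiableAt_const 0
  · obtain ⟨f', hf', rfl⟩ := h.exists_eq_dualFun_of_mem hg hg0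
    rw [dualFun_last]
    exact (wronskian_mem_entire (f := Fin.init f') (fun i => hf'.mem_entire i.castSucc) x).div
      (wronskian_mem_entire hf'.mem_entire x) (hf'.notMem_singularPoints_iff.1 hx)

theorem meromorphicAt_of_mem_conjugateSpace (h : IsEntireBasis V f) (hg : g ∈ conjugateSpace V)
    (z : ℂ) : MeromorphicAt g z := by
  rcases eq_or_ne g 0 with rfl | hg0
  · exact MeromorphicAt.const 0 z
  · obtain ⟨f', hf', rfl⟩ := h.exists_eq_dualFun_of_mem hg hg0
    rw [dualFun_last]
    exact meromorphicAt_wronskian_div (fun i => hf'.mem_entire i.castSucc) hf'.mem_entire z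

theorem meromorphicOrderAt_le_of_mem_conjugateSpace (h : IsEntireBasis V f)
    (hg : g ∈ conjugateSpace V) (hg0 : g ≠ 0) (z : ℂ) : meromorphicOrderAt g z ≤ (m : ℤ) := by
  obtain ⟨f', hf', rfl⟩ := h.exists_eq_dualFun_of_mem hg hg0
  rw [dualFun_last]
  exact meromorphicOrderAt_wronskian_init_div_le hf'.mem_entire hf'.linearIndependent z

-- By Lagrange's identity `g * monicOp f y` is the derivative of a quotient of Wronskians.
theorem circleIntegral_mul_monicOp (h : IsEntireBasis V f) (hg : g ∈ conjugateSpace V)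
    {y : ℂ → ℂ} (hy : y ∈ entire) (hr : 0 ≤ r)
    (hsphere : ∀ x ∈ Metric.sphere z r, x ∉ singularPoints V) :
    ∮ x in C(z, r), g x * monicOp f y x = 0 := by
  rcases eq_or_ne g 0 with rfl | hg0
  · simp [circleIntegral]
  · obtain ⟨f', hf', rfl⟩ := h.exists_eq_dualFun_of_mem hg hg0
    have hop : monicOp f y = monicOp f' y := by
      unfold monicOp
      rw [hf'.opCoeff_eq h]
    rw [hop, dualFun_last]
    exact circleIntegral.integral_eq_zero_of_hasDerivWithinAt hr fun x hx =>
      (hasDerivAt_wronskian_snoc_div hf'.mem_entire hf'.linearIndependent_init hy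
        (hf'.notMem_singularPoints_iff.1 (hsphere x hx))).hasDerivWithinAt

theorem holomorphicOffCenter_mul_polePolyInv (h : IsEntireBasis V f)
    (hS : ∀ z, z ∈ S ↔ z ∈ singularPoints V) (hsep : ∀ w ∈ S, w ≠ z → r < dist w z)
    (hg : g ∈ conjugateSpace V) : HolomorphicOffCenter (g * polePolyInv V S) z r := by
  refine ⟨fun x hx => ?_,
    (h.meromorphicAt_of_mem_conjugateSpace hg z).mul (meromorphicAt_polePolyInv V S z)⟩
  have hxS : x ∉ S := fun hxS => (hsep x hxS hx.2).not_ge hx.1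
  exact (h.differentiableAt_of_mem_conjugateSpace hg (mt (hS x).2 hxS)).mul
    ((polePoly V S).differentiableAt.inv (eval_polePoly_ne_zero V hxS))

theorem exists_meromorphicOrderAt_of_circleTransform_eq_zero (h : IsEntireBasis V f)
    (hS : ∀ z, z ∈ S ↔ z ∈ singularPoints V) (hz : z ∈ S) (hr : 0 < r)
    (hsep : ∀ w ∈ S, w ≠ z → r < dist w z) (hg : g ∈ conjugateSpace V) (hg0 : g ≠ 0)
    (hzero : circleTransform (g * polePolyInv V S) z r = 0) :
    ∃ n < m + 1 - poleOrder V z,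
      meromorphicOrderAt (g * polePolyInv V S) z = (n : ℤ) := by
  have hle := h.meromorphicOrderAt_le_of_mem_conjugateSpace hg hg0 z
  have hnonneg := (h.holomorphicOffCenter_mul_polePolyInv hS hsep
    hg).meromorphicOrderAt_nonneg_of_circleTransform_eq_zero hr hzero
  rw [meromorphicOrderAt_mul (h.meromorphicAt_of_mem_conjugateSpace hg z)
    (meromorphicAt_polePolyInv V S z), meromorphicOrderAt_polePolyInv] at hnonneg ⊢
  obtain ⟨e, he⟩ := WithTop.ne_top_iff_exists.1 (hle.trans_lt (WithTop.coe_lt_top _)).ne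
  rw [← he] at hle hnonneg ⊢
  have hroot := poleOrder_le_rootMultiplicity_polePoly V hz
  have he_le : e ≤ m := WithTop.coe_le_coe.1 hle
  have he_ge : 0 ≤ e + -((polePoly V S).rootMultiplicity z : ℤ) := WithTop.coe_le_coe.1 hnonneg
  refine ⟨(e + -((polePoly V S).rootMultiplicity z : ℤ)).toNat, by lia, ?_⟩
  rw [Int.toNat_of_nonneg he_ge]
  rfl

theorem circleTransform_mem_dualSpace (hS : ∀ z, z ∈ S ↔ z ∈ singularPoints V) (hz : z ∈ S)
    (hr : 0 < r) (hsep : ∀ w ∈ S, w ≠ z → r < dist w z) (hg : g ∈ conjugateSpace V) :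
    circleTransform (g * polePolyInv V S) z r ∈ dualSpace V :=
  Submodule.subset_span ⟨z, (hS z).1 hz, _,
    regConjugateSpace_eq_map hS ▸ Submodule.mem_map_of_mem hg, r, hr,
    fun w hw => hsep w ((hS w).2 hw), rfl⟩

theorem poleOrder_le_multiplicity (h : IsEntireBasis V f)
    (hS : ∀ z, z ∈ S ↔ z ∈ singularPoints V) [FiniteDimensional ℂ (dualSpace V)] (hz : z ∈ S) :
    poleOrder V z ≤ multiplicity (dualSpace V) z := by
  obtain ⟨r, hr, hsep⟩ := exists_pos_forall_lt_dist S z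
  have hreg (g : conjugateSpace V) : HolomorphicOffCenter (g * polePolyInv V S) z r :=
    h.holomorphicOffCenter_mul_polePolyInv hS hsep g.2
  set K := ((dualSpace V).comap (expPoly z)).map (expPoly z)
  have hfinK : FiniteDimensional ℂ K :=
    Submodule.finiteDimensional_of_le (Submodule.map_comap_le _ (dualSpace V))
  have hfinrankK : Module.finrank ℂ K = multiplicity (dualSpace V) z :=
    (Submodule.equivMapOfInjective _ (expPoly_injective z) _).finrank_eq.symm
  have hbound := finrank_le_finrank_add_of_circleTransform_mem hr (K := K)
    (((LinearMap.mulRight ℂ (polePolyInv V S)).domRestrict (conjugateSpace V)).codRestrict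
      (holomorphicOffCenter z r) hreg) (fun g => ?_) fun g hg0 =>
        h.exists_meromorphicOrderAt_of_circleTransform_eq_zero hS hz hr hsep g.2
          (Submodule.coe_eq_zero.not.2 hg0)
  · rw [h.finrank_conjugateSpace, hfinrankK] at hbound
    have := h.poleOrder_le z
    lia
  · obtain ⟨q, hq⟩ := (hreg g).exists_circleTransform_eq_expPoly hr
    have hmem := circleTransform_mem_dualSpace hS hz hr hsep g.2
    rw [hq] at hmem
    exact ⟨q, hmem, hq.symm⟩

end IsEntireBasis

/-! ### Linear differential equations with entire solutions -/

/-- The entire solutions `w` of the linear differential equation `∑ c_j(u) w⁽ʲ⁾(u) = 0`. -/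
noncomputable def entireSolutions {M : ℕ} (c : Fin (M + 1) → ℂ → ℂ) : Submodule ℂ (ℂ → ℂ) :=
  (LinearMap.ker (∑ j : Fin (M + 1),
    LinearMap.mulLeft ℂ (c j) ∘ₗ entire.subtype ∘ₗ entireDeriv ^ (j : ℕ))).map entire.subtype

theorem mem_entireSolutions {M : ℕ} {c : Fin (M + 1) → ℂ → ℂ} {w : ℂ → ℂ} :
    w ∈ entireSolutions c ↔
      w ∈ entire ∧ ∀ u, ∑ j : Fin (M + 1), c j u * iteratedDeriv (j : ℕ) w u = 0 := by
  constructor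
  · rintro ⟨w, hw, rfl⟩
    exact ⟨w.2, fun u => by simpa [coe_entireDeriv_pow] using congrFun hw u⟩
  · rintro ⟨hw, hsol⟩
    exact ⟨⟨w, hw⟩, funext fun u => by simpa [coe_entireDeriv_pow] using hsol u, rfl⟩

theorem rank_le_of_le_entireSolutions {M : ℕ} {c : Fin (M + 1) → ℂ → ℂ} {U : Submodule ℂ (ℂ → ℂ)}
    (hU : U ≤ entireSolutions c) {u₀ : ℂ} (hne : ∀ᶠ u in 𝓝[≠] u₀, c (Fin.last M) u ≠ 0) :
    Module.rank ℂ U ≤ M := by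
  by_contra! hlt
  rw [← Order.succ_le_iff, Cardinal.succ_natCast] at hlt
  obtain ⟨w, hw⟩ := Module.le_rank_iff (n := M + 1).1 (by exact_mod_cast hlt)
  have hind : LinearIndependent ℂ fun a => (w a : ℂ → ℂ) := hw.map' U.subtype U.ker_subtype
  have hsol a := mem_entireSolutions.1 (hU (w a).2)
  obtain ⟨u, hu, hW⟩ :=
    (hne.and (eventually_wronskian_ne_zero (fun a => (hsol a).1) hind u₀)).exists
  exact hu (congrFun (eq_zero_of_sum_mul_iteratedDeriv (c := fun j => c j u) hW
    fun a => (hsol a).2 u) (Fin.last M))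

theorem IsEntireBasis.opCoeff_eq_of_le_entireSolutions {M : ℕ} {c : Fin (M + 1) → ℂ → ℂ}
    {U : Submodule ℂ (ℂ → ℂ)} {f : Fin M → ℂ → ℂ} (h : IsEntireBasis U f)
    (hU : U ≤ entireSolutions c) {x : ℂ} (hx : x ∉ singularPoints U) (hne : c (Fin.last M) x ≠ 0)
    (j : Fin (M + 1)) : opCoeff f j x = (c (Fin.last M) x)⁻¹ * c j x := by
  refine opCoeff_eq_of_sum_mul_iteratedDeriv (h.notMem_singularPoints_iff.1 hx)
    (c := fun j => (c (Fin.last M) x)⁻¹ * c j x) (inv_mul_cancel₀ hne) (fun a => ?_) j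
  simp only [mul_assoc, ← Finset.mul_sum]
  rw [(mem_entireSolutions.1 (hU (h.mem a))).2 x, mul_zero]

/-! ### The operator annihilating the dual space -/

theorem monicOp_exp {N : ℕ} (f : Fin N → ℂ → ℂ) (u x : ℂ) :
    monicOp f (fun y => Complex.exp (u * y)) x =
      (∑ k : Fin (N + 1), opCoeff f k x * u ^ (k : ℕ)) * Complex.exp (u * x) := by
  rw [monicOp, Finset.sum_mul]
  exact Finset.sum_congr rfl fun k _ => by rw [iteratedDeriv_cexp_const_mul, mul_assoc]

/-- The coefficient of `∂_uʲ` in the operator obtained from `∑ A_k(x) ∂_xᵏ` by replacing `x` with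
`∂_u` and `∂_x` with multiplication by `u`. -/
noncomputable def dualCoeff {N : ℕ} (A : Fin N → ℂ[X]) (j : ℕ) (u : ℂ) : ℂ :=
  ∑ k : Fin N, (A k).coeff j * u ^ (k : ℕ)

theorem sum_dualCoeff_mul_pow {N M : ℕ} {A : Fin N → ℂ[X]} (hdeg : ∀ k, (A k).natDegree ≤ M)
    (u x : ℂ) : ∑ j : Fin (M + 1), dualCoeff A j u * x ^ (j : ℕ) =
      ∑ k : Fin N, (A k).eval x * u ^ (k : ℕ) := by
  simp only [dualCoeff, Finset.sum_mul]
  rw [Finset.sum_comm]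
  refine Finset.sum_congr rfl fun k _ => ?_
  rw [eval_eq_sum_range' (Nat.lt_succ_of_le (hdeg k)), Finset.sum_range, Finset.sum_mul]
  exact Finset.sum_congr rfl fun j _ => mul_right_comm _ _ _

theorem sum_dualCoeff_mul_iteratedDeriv_circleTransform {N M : ℕ} {A : Fin N → ℂ[X]}
    (hdeg : ∀ k, (A k).natDegree ≤ M) {f : ℂ → ℂ} {z : ℂ} {r : ℝ} (hr : 0 ≤ r)
    (hf : ContinuousOn f (Metric.sphere z r)) (u : ℂ) :
    ∑ j : Fin (M + 1), dualCoeff A j u * iteratedDeriv (j : ℕ) (circleTransform f z r) u =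
      circleTransform (fun x => (∑ k : Fin N, (A k).eval x * u ^ (k : ℕ)) * f x) z r u := by
  simp only [iteratedDeriv_circleTransform hr hf, circleTransform,
    ← circleIntegral.integral_const_mul]
  rw [← circleIntegral.integral_fun_sum fun j _ => ContinuousOn.circleIntegrable hr (by fun_prop)]
  refine circleIntegral.integral_congr hr fun x _ => ?_
  simp only [← sum_dualCoeff_mul_pow hdeg, Finset.sum_mul, Finset.mul_sum]
  exact Finset.sum_congr rfl fun j _ => by ring

namespace IsEntireBasis

variable {m : ℕ} {V : Submodule ℂ (ℂ → ℂ)} {f : Fin (m + 1) → ℂ → ℂ} {S : Finset ℂ}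
  {A : Fin (m + 2) → ℂ[X]}

theorem circleTransform_sum_eval_mul_eq_zero (h : IsEntireBasis V f)
    (hS : ∀ z, z ∈ S ↔ z ∈ singularPoints V)
    (hA : ∀ k x, x ∉ S → (polePoly V S).eval x * opCoeff f k x = (A k).eval x) {z : ℂ} {r : ℝ}
    (hr : 0 ≤ r) (hsphere : ∀ x ∈ Metric.sphere z r, x ∉ S) {g : ℂ → ℂ}
    (hg : g ∈ conjugateSpace V) (u : ℂ) :
    circleTransform (fun x => (∑ k : Fin (m + 2), (A k).eval x * u ^ (k : ℕ)) *
      (g * polePolyInv V S) x) z r u = 0 := by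
  rw [← h.circleIntegral_mul_monicOp hg (y := fun y => Complex.exp (u * y))
    (Bispectral.mem_entire.2 (by fun_prop)) hr fun x hx => mt (hS x).2 (hsphere x hx)]
  refine circleIntegral.integral_congr hr fun x hx => ?_
  have hP := eval_polePoly_ne_zero V (hsphere x hx)
  simp only [monicOp_exp, ← hA _ x (hsphere x hx), mul_assoc, ← Finset.mul_sum, Pi.mul_apply,
    polePolyInv]
  field_simp

theorem dualSpace_le_entireSolutions (h : IsEntireBasis V f)
    (hS : ∀ z, z ∈ S ↔ z ∈ singularPoints V) {M : ℕ} (hdeg : ∀ k, (A k).natDegree ≤ M)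
    (hA : ∀ k x, x ∉ S → (polePoly V S).eval x * opCoeff f k x = (A k).eval x) :
    dualSpace V ≤ entireSolutions fun j : Fin (M + 1) => dualCoeff A j := by
  refine Submodule.span_le.2 ?_
  rintro _ ⟨z, -, g, hg, r, hr, hsep, rfl⟩
  rw [regConjugateSpace_eq_map hS] at hg
  obtain ⟨g, hg, rfl⟩ := hg
  have hsepS : ∀ w ∈ S, w ≠ z → r < dist w z := fun w hw => hsep w ((hS w).1 hw)
  have hhol := h.holomorphicOffCenter_mul_polePolyInv hS hsepS hg
  have hsphere : ∀ x ∈ Metric.sphere z r, x ∉ S := fun x hx hxS =>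
    (hsepS x hxS (Metric.ne_of_mem_sphere hx hr.ne')).ne' hx
  refine mem_entireSolutions.2 ⟨?_, fun u => ?_⟩
  · obtain ⟨q, hq⟩ := hhol.exists_circleTransform_eq_expPoly hr
    change circleTransform (g * polePolyInv V S) z r ∈ entire
    exact hq ▸ expPoly_mem_entire z q
  · exact (sum_dualCoeff_mul_iteratedDeriv_circleTransform hdeg hr.le
      (hhol.continuousOn_sphere hr) u).trans
      (h.circleTransform_sum_eval_mul_eq_zero hS hA hr.le hsphere hg u)

end IsEntireBasis

/-! ### Bispectral duality -/

theorem sum_coeff_prod_X_sub_C_mul_pow {R : Type*} [CommRing R] {N : ℕ} (l : Fin N → R) (x : R) :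
    ∑ k : Fin (N + 1), (∏ a, (X - C (l a))).coeff k * x ^ (k : ℕ) = ∏ a, (x - l a) := by
  nontriviality R
  have heval := eval_eq_sum_range' (p := ∏ a, (X - C (l a))) (n := N + 1) (by simp) x
  rw [Finset.sum_range] at heval
  rw [← heval, eval_prod]
  simp only [eval_sub, eval_X, eval_C]

namespace IsExpPolyBasis

theorem bakerAkhiezer_eq {N : ℕ} {V : Submodule ℂ (ℂ → ℂ)} {l : Fin N → ℂ} {p : Fin N → ℂ[X]}
    (h : IsExpPolyBasis V l p) (x ξ : ℂ) :
    bakerAkhiezer (subspaceOf V) x ξ = (∏ᶠ z : ℂ, (ξ - z) ^ multiplicity V z)⁻¹ *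
      ((∑ k : Fin (N + 1), opCoeff (fun a => expPoly (l a) (p a)) k x * ξ ^ (k : ℕ)) *
        Complex.exp (ξ * x)) := by
  simp only [bakerAkhiezer, h.quasiPolySpaceOf_subspaceOf, h.monicOperator_eq, mul_comm _ ξ,
    monicOp_exp]

variable {m : ℕ} {V : Submodule ℂ (ℂ → ℂ)} {l : Fin (m + 1) → ℂ} {p : Fin (m + 1) → ℂ[X]}
  {S : Finset ℂ}

theorem rank_dualSpace_le (h : IsExpPolyBasis V l p) (hS : ∀ z, z ∈ S ↔ z ∈ singularPoints V) :
    Module.rank ℂ (dualSpace V) ≤ (polePoly V S).natDegree := by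
  obtain ⟨A, hdeg, hlead, hA⟩ := h.exists_polePoly_mul_opCoeff_eq_eval hS
  refine rank_le_of_le_entireSolutions (u₀ := 0) (h.dualSpace_le_entireSolutions hS hdeg hA) ?_
  simp only [Fin.val_last, dualCoeff, hlead, sum_coeff_prod_X_sub_C_mul_pow]
  have hmonic : (∏ a, (X - C (l a))).Monic := monic_prod_of_monic _ _ fun a _ => monic_X_sub_C _
  filter_upwards [nhdsNE_le_cofinite 0 (eventually_eval_ne_zero hmonic.ne_zero)] with x hx
  simpa [eval_prod] using hx

theorem finiteDimensional_dualSpace (h : IsExpPolyBasis V l p) :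
    FiniteDimensional ℂ (dualSpace V) :=
  Module.rank_lt_aleph0_iff.1 <|
    (h.rank_dualSpace_le (S := h.finite_singularPoints.toFinset) (by simp)).trans_lt
      (Cardinal.natCast_lt_aleph0)

theorem multiplicity_dualSpace (h : IsExpPolyBasis V l p)
    (hS : ∀ z, z ∈ S ↔ z ∈ singularPoints V) :
    (∀ z ∈ S, multiplicity (dualSpace V) z = poleOrder V z) ∧
      ∀ z ∉ S, multiplicity (dualSpace V) z = 0 := by
  have := h.finiteDimensional_dualSpace
  refine multiplicity_eq_of_le (fun z hz => IsEntireBasis.poleOrder_le_multiplicity h hS hz) ?_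
  exact natDegree_polePoly V S ▸ Module.finrank_le_of_rank_le (h.rank_dualSpace_le hS)

theorem finrank_dualSpace (h : IsExpPolyBasis V l p) (hS : ∀ z, z ∈ S ↔ z ∈ singularPoints V) :
    Module.finrank ℂ (dualSpace V) = (polePoly V S).natDegree := by
  have := h.finiteDimensional_dualSpace
  refine (Module.finrank_le_of_rank_le (h.rank_dualSpace_le hS)).antisymm ?_
  rw [natDegree_polePoly, ← Finset.sum_congr rfl (h.multiplicity_dualSpace hS).1]
  exact sum_multiplicity_le _ S

theorem isBispectralDual_subspaceOf_dualSpace (h : IsExpPolyBasis V l p) {M : ℕ} {l' : Fin M → ℂ}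
    {p' : Fin M → ℂ[X]} (h' : IsExpPolyBasis (dualSpace V) l' p') :
    IsBispectralDual (subspaceOf V) (subspaceOf (dualSpace V)) := by
  obtain ⟨S, hS⟩ : ∃ S : Finset ℂ, ∀ z, z ∈ S ↔ z ∈ singularPoints V :=
    ⟨h.finite_singularPoints.toFinset, by simp⟩
  obtain ⟨A, hdeg, hlead, hA⟩ := h.exists_polePoly_mul_opCoeff_eq_eval hS
  obtain rfl : M = (polePoly V S).natDegree := h'.finrank_eq.symm.trans (h.finrank_dualSpace hS)
  intro x ξ hY hW
  rw [bakerAkhiezerDomain, h'.quasiPolySpaceOf_subspaceOf] at hY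
  rw [bakerAkhiezerDomain, h.quasiPolySpaceOf_subspaceOf] at hW
  have hξ : ξ ∉ S := mt (hS ξ).1 hW.1
  have hP := eval_polePoly_ne_zero V hξ
  have hlast : dualCoeff A (polePoly V S).natDegree x = ∏ a, (x - l a) := by
    simp only [dualCoeff, hlead, sum_coeff_prod_X_sub_C_mul_pow]
  have hQ : ∏ a, (x - l a) ≠ 0 := h.prod_sub_ne_zero hW.2
  have hopV (k) : opCoeff (fun a => expPoly (l a) (p a)) k ξ =
      ((polePoly V S).eval ξ)⁻¹ * (A k).eval ξ := by
    rw [← hA k ξ hξ, inv_mul_cancel_left₀ hP]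
  have hopU (j) : opCoeff (fun a => expPoly (l' a) (p' a)) j x =
      (∏ a, (x - l a))⁻¹ * dualCoeff A j x := by
    rw [h'.opCoeff_eq_of_le_entireSolutions (h.dualSpace_le_entireSolutions hS hdeg hA) hY.1] <;>
      simp only [Fin.val_last, hlast, hQ, ne_eq, not_false_iff]
  have hmult := h.multiplicity_dualSpace hS
  rw [h'.bakerAkhiezer_eq, h.bakerAkhiezer_eq, h.finprod_sub_pow_multiplicity,
    Bispectral.finprod_sub_pow_multiplicity hmult.1 hmult.2, ← eval_polePoly]
  simp only [hopV, hopU, mul_assoc, ← Finset.mul_sum, sum_dualCoeff_mul_pow hdeg]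
  rw [mul_comm ξ x]
  ring

end IsExpPolyBasis

end Bispectral

theorem mainTheorem8 (V U : Submodule ℂ (ℂ → ℂ))
    (hV : Bispectral.IsQuasiPolynomialSpace V) (hU : Bispectral.IsQuasiPolynomialSpace U)
    (hVU : U = Bispectral.dualSpace V) :
    Bispectral.subspaceOf V ∈ Bispectral.Gr ∧ Bispectral.subspaceOf U ∈ Bispectral.Gr ∧
      Bispectral.IsBispectralDual (Bispectral.subspaceOf V) (Bispectral.subspaceOf U) := by
  subst hVU
  obtain ⟨m, l, p, h⟩ := hV.exists_isExpPolyBasis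
  obtain ⟨m', l', p', h'⟩ := hU.exists_isExpPolyBasis
  exact ⟨hV.subspaceOf_mem_Gr, hU.subspaceOf_mem_Gr, h.isBispectralDual_subspaceOf_dualSpace h'⟩
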